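/- Let $\mathcal H=\mathbb C^d$, let $\mathcal S\subset\mathcal L(\mathcal H)$ be a nonempty set of density operators, and let $N,M\ge 0$ be integers. For a density operator $\sigma$ let $\mathcal T_\sigma[X]=\operatorname{tr}(X)\,\sigma$ denote the trash-and-replace channel, and put $\mathcal C=\{\mathcal T_\rho:\mathcal L(\mathcal H)\to\mathcal L(\mathcal H)\mid\rho\in\mathcal S\}$. Let $F(\rho,\sigma)=\operatorname{tr}|\sqrt\rho\sqrt\sigma|$ and, for channels $\mathcal A,\mathcal B$, let $$F_{\rm CJ}(\mathcal A,\mathcal B)=F\big((\mathrm{id}\otimes\mathcal A)[\Phi^+],(\mathrm{id}\otimes\mathcal B)[\Phi^+]\big),\qquad F_\diamond(\mathcal A,\mathcal B)=\min_\Psi F\big((\mathrm{id}\otimes\mathcal A)[\Psi],(\mathrm{id}\otimes\mathcal B)[\Psi]\big),$$ where $\Phi^+$ is the maximally entangled state and $\Psi$ ranges over the pure states of the doubled input space. A process with $N$ slots is a linear map $\mathbf P$ taking $\mathcal L(\mathcal H\to\mathcal H)^{\otimes N}$ to $\mathcal L(\mathcal H^{\otimes M}\to\mathcal H^{\otimes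 M})$, and $\mathbf P[\mathcal E^{\times N}]:=\mathbf P[\mathcal E^{\otimes N}]$. It is parallel if $\mathbf P[\mathcal E_1,\dots,\mathcal E_N]=\mathcal D\circ(\mathrm{id}\otimes\mathcal E_1\otimes\cdots\otimes\mathcal E_N)\circ\mathcal V$ for channels $\mathcal V,\mathcal D$ sharing a finite-dimensional memory; sequential if $\mathbf P[\mathcal E_1,\dots,\mathcal E_N]=\mathcal V_N\circ(\mathrm{id}\otimes\mathcal E_N)\circ\mathcal V_{N-1}\circ\cdots\circ(\mathrm{id}\otimes\mathcal E_1)\circ\mathcal V_0$ for channels $\mathcal V_0,\dots,\mathcal V_N$ with finite-dimensional memories; general (non-causal) if it maps every $N$-tuple of trace-preserving maps to a trace-preserving map and every extension $\mathrm{id}\otimes\mathbf P$ by finite-dimensional spectator systems maps completely positive maps to completely positive maps. Define $$\mathsf F^{\mathcal S}=\max_{\mathcal P}\inf_{\rho\in\mathcal S}F\big(\mathcal P[\rho^{\otimes N}],\rho^{\otimes M}\big),\qquad \mathsf F^{\mathcal C}_\bullet=\max_{\mathbf P}\inf_{\mathcal E\in\mathcal C}F_\bullet\big(\mathbf P[\mathcal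 E^{\times N}],\mathcal E^{\otimes M}\big),\quad \bullet\in\{{\rm CJ},\diamond\},$$ with $\mathcal P$ ranging over the CPTP maps $\mathcal L(\mathcal H^{\otimes N})\to\mathcal L(\mathcal H^{\otimes M})$ and $\mathbf P$ over one of the three classes of processes. (i) All these maxima exist and, for each of the three classes, $\mathsf F^{\mathcal C}_{\rm CJ}=\mathsf F^{\mathcal C}_\diamond=\mathsf F^{\mathcal S}$. (ii) For every CPTP map $\mathcal P:\mathcal L(\mathcal H^{\otimes N})\to\mathcal L(\mathcal H^{\otimes M})$ there is a process $\mathbf P$, belonging to all three classes, such that for every state $\rho$ one has $\mathbf P[\mathcal T_\rho^{\times N}]=\mathcal T_{\mathcal P[\rho^{\otimes N}]}$ and $F_{\rm CJ}(\mathbf P[\mathcal T_\rho^{\times N}],\mathcal T_\rho^{\otimes M})=F_\diamond(\mathbf P[\mathcal T_\rho^{\times N}],\mathcal T_\rho^{\otimes M})=F(\mathcal P[\rho^{\otimes N}],\rho^{\otimes M})$. (iii) For every process $\mathbf P$ in any of the three classes there is a CPTP map $\mathcal P:\mathcal L(\mathcal H^{\otimes N})\to\mathcal L(\mathcal H^{\otimes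 M})$ such that for every state $\rho$: $\mathcal P[\rho^{\otimes N}]=\mathbf P[\mathcal T_\rho^{\times N}][\mathbb 1/d^M]$; if $\mathbf P[\mathcal T_\rho^{\times N}]$ is a trash-and-replace channel, then it equals $\mathcal T_{\mathcal P[\rho^{\otimes N}]}$; and $F_\diamond(\mathbf P[\mathcal T_\rho^{\times N}],\mathcal T_\rho^{\otimes M})\le F_{\rm CJ}(\mathbf P[\mathcal T_\rho^{\times N}],\mathcal T_\rho^{\otimes M})\le F(\mathcal P[\rho^{\otimes N}],\rho^{\otimes M})$. (iv) For every process $\mathbf P$ in any of the three classes there is a CPTP map $\mathcal G:\mathcal L(\mathcal H^{\otimes M}\otimes\mathcal H^{\otimes N})\to\mathcal L(\mathcal H^{\otimes M})$, independent of $\rho$, with $\mathbf P[\mathcal T_\rho^{\times N}][X]=\mathcal G[X\otimes\rho^{\otimes N}]$ for all states $\rho$ and all operators $X$. Conversely, every such CPTP map $\mathcal G$ arises in this way from a process belonging to all three classes. -/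

import Mathlib

open scoped ComplexOrder MatrixOrder Kronecker

noncomputable section

namespace QCloning

/-! ### Operators, states, channels

A finite-dimensional Hilbert space with a fixed orthonormal basis is represented by the finite type
indexing the basis; the tensor product of spaces corresponds to the product of the index types, and
the tensor power `H^{⊗N}` to the functions `Fin N → a`. -/

/-- The linear operators on the Hilbert space with basis indexed by `a`. -/
abbrev Op (a : Type) : Type := Matrix a a ℂ

/-- The linear maps `L(H₁) → L(H₂)`. -/
abbrev SuperOp (a b : Type) : Type := Op a →ₗ[ℂ] Op b

/-- Density operators. -/
structure IsState {a : Type} [Fintype a] (ρ : Op a) : Prop where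
  posSemidef : ρ.PosSemidef
  trace_eq_one : ρ.trace = 1

/-- The map `id_c ⊗ Φ`. -/
def idTensor (c : Type) {a b : Type} (Φ : SuperOp a b) : SuperOp (c × a) (c × b) where
  toFun X := Matrix.of fun r s => Φ (Matrix.of fun i j => X (r.1, i) (s.1, j)) r.2 s.2
  map_add' X Y := by
    ext r s
    exact congrFun (congrFun (map_add Φ (Matrix.of fun i j => X (r.1, i) (s.1, j))
      (Matrix.of fun i j => Y (r.1, i) (s.1, j))) r.2) s.2
  map_smul' z X := by
    ext r s
    exact congrFun (congrFun (map_smul Φ z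
      (Matrix.of fun i j => X (r.1, i) (s.1, j))) r.2) s.2

/-- Complete positivity: `id_k ⊗ Φ` is positive for every finite ancilla dimension `k`. -/
def IsCP {a b : Type} (Φ : SuperOp a b) : Prop :=
  ∀ (k : ℕ) (X : Op (Fin k × a)), X.PosSemidef → (idTensor (Fin k) Φ X).PosSemidef

/-- Trace preservation. -/
def IsTP {a b : Type} [Fintype a] [Fintype b] (Φ : SuperOp a b) : Prop :=
  ∀ X : Op a, (Φ X).trace = X.trace

/-- Quantum channels: completely positive trace-preserving maps. -/
structure IsChannel {a b : Type} [Fintype a] [Fintype b] (Φ : SuperOp a b) : Prop where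
  cp : IsCP Φ
  tp : IsTP Φ

/-- The tensor power `ρ^{⊗N}`. -/
def tensorPow (N : ℕ) {a : Type} (ρ : Op a) : Op (Fin N → a) :=
  Matrix.of fun p q => ∏ i, ρ (p i) (q i)

/-- The tensor product `E₁ ⊗ ⋯ ⊗ E_N` of linear maps, written out on the matrix units
`|p⟩⟨q| = ⨂ |pᵢ⟩⟨qᵢ|`. -/
def tensorMap {N : ℕ} {a b : Type} [Fintype a] [DecidableEq a] (E : Fin N → SuperOp a b) :
    SuperOp (Fin N → a) (Fin N → b) where
  toFun X := Matrix.of fun r s =>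
    ∑ p, ∑ q, X p q * ∏ i, E i (Matrix.single (p i) (q i) 1) (r i) (s i)
  map_add' X Y := by
    ext r s
    simp [add_mul, Finset.sum_add_distrib]
  map_smul' z X := by
    ext r s
    simp [mul_assoc, Finset.mul_sum]

/-- The trash-and-replace channel `T_σ[X] = tr(X) σ`, so `T_σ[τ] = σ` for every state `τ`. -/
def trashReplace (a : Type) {b : Type} [Fintype a] (σ : Op b) : SuperOp a b :=
  (Matrix.traceLinearMap a ℂ ℂ).smulRight σ

/-- The maximally mixed state `𝟙 / d`. -/
def maxMixed (a : Type) [Fintype a] [DecidableEq a] : Op a := ((Fintype.card a : ℂ)⁻¹) • 1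

/-! ### Fidelities -/

/-- The fidelity `F(ρ, σ) = tr |√ρ √σ|`. -/
def fidelity {a : Type} [Fintype a] [DecidableEq a] (ρ σ : Op a) : ℝ :=
  (CFC.abs (CFC.sqrt ρ * CFC.sqrt σ)).trace.re

/-- The rank-one operator `|ψ⟩⟨ψ|`. -/
def pureOp {a : Type} (ψ : a → ℂ) : Op a := Matrix.vecMulVec ψ (star ψ)

/-- The maximally entangled vector `d^{-1/2} ∑ᵢ |ii⟩`. -/
def maxEntVec (a : Type) [Fintype a] [DecidableEq a] : a × a → ℂ :=
  fun x => if x.1 = x.2 then (((Real.sqrt (Fintype.card a))⁻¹ : ℝ) : ℂ) else 0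

/-- The Choi–Jamiołkowski state `(id ⊗ A)[|Φ⁺⟩⟨Φ⁺|]`. -/
def choi {a b : Type} [Fintype a] [DecidableEq a] (A : SuperOp a b) : Op (a × b) :=
  idTensor a A (pureOp (maxEntVec a))

/-- The Choi–Jamiołkowski fidelity of two channels. -/
def fidCJ {a b : Type} [Fintype a] [DecidableEq a] [Fintype b] [DecidableEq b]
    (A B : SuperOp a b) : ℝ :=
  fidelity (choi A) (choi B)

/-- The diamond (worst-case) fidelity: the minimum, over the pure states `Ψ` of `H₁' ⊗ H₁`, of the
fidelity between `(id ⊗ A)[Ψ]` and `(id ⊗ B)[Ψ]`. -/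
def fidDiamond {a b : Type} [Fintype a] [Fintype b] [DecidableEq a] [DecidableEq b]
    (A B : SuperOp a b) : ℝ :=
  ⨅ ψ : {ψ : a × a → ℂ // star ψ ⬝ᵥ ψ = 1},
    fidelity (idTensor a A (pureOp ψ.1)) (idTensor a B (pureOp ψ.1))

/-! ### Processes

A process with `N` input channels `L(H₁) → L(H₂)` is a linear map
`L(H₁ → H₂)^{⊗N} → L(H_in → H_out)`; here `L(H₁ → H₂)^{⊗N} = L(H₁^{⊗N} → H₂^{⊗N})`. -/

/-- Linear maps `L(H₁ → H₂)^{⊗N} → L(H_in → H_out)`. -/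
abbrev HigherMap (N : ℕ) (a b i o : Type) : Type :=
  SuperOp (Fin N → a) (Fin N → b) →ₗ[ℂ] SuperOp i o

/-- `P[E^{×N}]`: the higher-order map `P` used with `N` copies of `E`. -/
def HigherMap.query {N : ℕ} {a b i o : Type} [Fintype a] [DecidableEq a]
    (P : HigherMap N a b i o) (E : SuperOp a b) : SuperOp i o :=
  P (tensorMap fun _ => E)

/-- The block `X ↦ ⟨y| Φ(|x⟩⟨x'| ⊗ X) |y'⟩` of a map `Φ` on an extended system. -/
def block {k l a b : Type} [DecidableEq k] (Φ : SuperOp (k × a) (l × b)) (x x' : k) (y y' : l) :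
    SuperOp a b where
  toFun X := Matrix.of fun p q => Φ (Matrix.single x x' (1 : ℂ) ⊗ₖ X) (y, p) (y', q)
  map_add' X Y := by
    ext p q
    simp [Matrix.kronecker_add]
  map_smul' z X := by
    ext p q
    simp [Matrix.kronecker_smul]

/-- The extension `id ⊗ P` of a higher-order map `P`, acting on maps `L(K ⊗ H₁) → L(L ⊗ H₂)` with
spectator systems `K`, `L`. It is determined by `(id ⊗ P)(Λ ⊗ Θ) = Λ ⊗ P(Θ)`. -/
def extendHigher {k l a b i o : Type} [Fintype k] [DecidableEq k]
    (P : SuperOp a b →ₗ[ℂ] SuperOp i o) (Φ : SuperOp (k × a) (l × b)) :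
    SuperOp (k × i) (l × o) where
  toFun Y := Matrix.of fun r s =>
    ∑ x, ∑ x', P (block Φ x x' r.1 s.1) (Matrix.of fun p q => Y (x, p) (x', q)) r.2 s.2
  map_add' Y Z := by
    ext r s
    have h : ∀ x x', P (block Φ x x' r.1 s.1) (Matrix.of fun p q => (Y + Z) (x, p) (x', q))
        = P (block Φ x x' r.1 s.1) (Matrix.of fun p q => Y (x, p) (x', q))
        + P (block Φ x x' r.1 s.1) (Matrix.of fun p q => Z (x, p) (x', q)) :=
      fun x x' => map_add (P (block Φ x x' r.1 s.1)) (Matrix.of fun p q => Y (x, p) (x', q))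
        (Matrix.of fun p q => Z (x, p) (x', q))
    simp only [Matrix.of_apply, Matrix.add_apply, ← Finset.sum_add_distrib] at h ⊢
    exact Finset.sum_congr rfl fun x _ => Finset.sum_congr rfl fun x' _ => by
      rw [h x x', Matrix.add_apply]
  map_smul' z Y := by
    ext r s
    have h : ∀ x x', P (block Φ x x' r.1 s.1) (Matrix.of fun p q => (z • Y) (x, p) (x', q))
        = z • P (block Φ x x' r.1 s.1) (Matrix.of fun p q => Y (x, p) (x', q)) :=
      fun x x' => map_smul (P (block Φ x x' r.1 s.1)) z (Matrix.of fun p q => Y (x, p) (x', q))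
    simp only [Matrix.of_apply, Matrix.smul_apply, Finset.smul_sum, RingHom.id_apply] at h ⊢
    exact Finset.sum_congr rfl fun x _ => Finset.sum_congr rfl fun x' _ => by
      rw [h x x', Matrix.smul_apply]

/-- General (possibly non-causally ordered) processes with `N` input channels: whenever the `N`
inputs are trace preserving so is the output, and complete positivity is preserved, also when the
maps the process acts on are extended by spectator systems. -/
structure IsProcess {N : ℕ} {a b i o : Type} [Fintype a] [DecidableEq a] [Fintype b]
    [Fintype i] [Fintype o] (P : HigherMap N a b i o) : Prop where
  tpp : ∀ E : Fin N → SuperOp a b, (∀ n, IsTP (E n)) → IsTP (P (tensorMap E))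
  ccpp : ∀ (k l : ℕ) (Φ : SuperOp (Fin k × (Fin N → a)) (Fin l × (Fin N → b))),
    IsCP Φ → IsCP (extendHigher P Φ)

/-- Parallel processes: `P[E₁,…,E_N] = D ∘ (id_k ⊗ E₁ ⊗ ⋯ ⊗ E_N) ∘ V` with an encoding channel `V`
and a decoding channel `D`, sharing a memory of some finite dimension `k`. -/
def IsParallel {N : ℕ} {a b i o : Type} [Fintype a] [Fintype b] [Fintype i] [Fintype o]
    (P : HigherMap N a b i o) : Prop :=
  ∃ (k : ℕ) (V : SuperOp i (Fin k × (Fin N → a))) (D : SuperOp (Fin k × (Fin N → b)) o),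
    IsChannel V ∧ IsChannel D ∧
      ∀ Φ : SuperOp (Fin N → a) (Fin N → b), P Φ = D ∘ₗ idTensor (Fin k) Φ ∘ₗ V

/-- `F` is a sequential circuit with `N` slots:
`F(E₁,…,E_N) = V_N ∘ (id ⊗ E_N) ∘ V_{N-1} ∘ ⋯ ∘ V₁ ∘ (id ⊗ E₁) ∘ V₀`
with channels `V₀,…,V_N` and memories of arbitrary finite dimensions. -/
def IsSeqCircuit {a b i : Type} [Fintype a] [Fintype b] [Fintype i] :
    (N : ℕ) → (o : Type) → [Fintype o] → ((Fin N → SuperOp a b) → SuperOp i o) → Prop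
  | 0, _, _, F => ∃ V, IsChannel V ∧ ∀ E, F E = V
  | N + 1, o, _, F =>
    ∃ (k : ℕ) (G : (Fin N → SuperOp a b) → SuperOp i (Fin k × a)) (V : SuperOp (Fin k × b) o),
      IsSeqCircuit N (Fin k × a) G ∧ IsChannel V ∧
        ∀ E, F E = V ∘ₗ idTensor (Fin k) (E (Fin.last N)) ∘ₗ G (Fin.init E)

/-- Sequential processes. -/
def IsSequential {N : ℕ} {a b i o : Type} [Fintype a] [DecidableEq a] [Fintype b]
    [Fintype i] [Fintype o] (P : HigherMap N a b i o) : Prop :=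
  IsSeqCircuit N o fun E : Fin N → SuperOp a b => P (tensorMap E)

/-- The three classes of processes. -/
inductive ProcessClass
  | parallel
  | sequential
  | nonCausal

/-- `P` is a process of class `c`. -/
def ProcessClass.Mem {N : ℕ} {a b i o : Type} [Fintype a] [DecidableEq a] [Fintype b]
    [Fintype i] [Fintype o] (c : ProcessClass) (P : HigherMap N a b i o) : Prop :=
  match c with
  | .parallel => IsParallel P
  | .sequential => IsSequential P
  | .nonCausal => IsProcess P

/-! ### Optimal cloning -/

/-- The worst-case fidelities over `S` attained by `N → M` state cloning maps. -/
def stateCloningValues {a : Type} [Fintype a] [DecidableEq a] (S : Set (Op a)) (N M : ℕ) :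
    Set ℝ :=
  {f | ∃ R : SuperOp (Fin N → a) (Fin M → a), IsChannel R ∧
    f = ⨅ ρ : S, fidelity (R (tensorPow N ρ.1)) (tensorPow M ρ.1)}

/-- The optimal worst-case fidelity of `N → M` cloning of the set of states `S`. -/
def optStateFid {a : Type} [Fintype a] [DecidableEq a] (S : Set (Op a)) (N M : ℕ) : ℝ :=
  sSup (stateCloningValues S N M)

/-- The worst-case values over `C` of the channel figure of merit `F` attained by `N → M` cloning
processes of class `c`. -/
def channelCloningValues {a : Type} [Fintype a] [DecidableEq a] (c : ProcessClass)
    (C : Set (SuperOp a a)) (N M : ℕ)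
    (F : SuperOp (Fin M → a) (Fin M → a) → SuperOp (Fin M → a) (Fin M → a) → ℝ) : Set ℝ :=
  {f | ∃ P : HigherMap N a a (Fin M → a) (Fin M → a), c.Mem P ∧
    f = ⨅ E : C, F (P.query E.1) (tensorMap fun _ => E.1)}

/-- The optimal CJ fidelity of `N → M` cloning of the set of channels `C` with processes of
class `c`. -/
def optCJFid {a : Type} [Fintype a] [DecidableEq a] (c : ProcessClass) (C : Set (SuperOp a a))
    (N M : ℕ) : ℝ :=
  sSup (channelCloningValues c C N M fidCJ)

/-- The optimal diamond fidelity of `N → M` cloning of the set of channels `C` with processes of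
class `c`. -/
def optDiamondFid {a : Type} [Fintype a] [DecidableEq a] (c : ProcessClass)
    (C : Set (SuperOp a a)) (N M : ℕ) : ℝ :=
  sSup (channelCloningValues c C N M fidDiamond)

end QCloning

end

open QCloning

/-!
A trash-and-replace channel ignores its input, so the only resource that it supplies is the state
that it prepares. A process whose slots are filled with `T_ρ` therefore acts as
`X ↦ G[X ⊗ ρ^{⊗N}]` for a fixed channel `G` (`ProcessClass.Mem.exists_contraction`). For parallel
and sequential circuits `G` is read off the circuit. For a general process it arises by applying
the extended process to the completely positive map `id_B ⊗ tr_A`, whose spectator input carries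
the prepared state; this gives complete positivity, while trace preservation is inherited on
products of trace-one operators, which span. Conversely, every channel `G` comes from the process
that inserts a fixed state into all slots and applies `G` to its own input and to the outputs of the
slots (`probe`), and this process lies in all three classes (`mem_probe`).

Feeding the maximally mixed state into `G` turns a cloning process into a cloning map for states.
Its fidelity dominates the CJ fidelity because the reference system of the Choi–Jamiołkowski state
is maximally mixed and uncorrelated for the target channel, and the fidelity is monotone under
discarding it (`fidelity_maxMixed_kronecker_le`). The proof of this monotonicity combines a polar
decomposition, the operator Cauchy–Schwarz inequality for the partial trace, and operator
monotonicity of the square root. Conversely, a cloning map `R` yields the process that discards its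
input and applies `R`; it sends `T_ρ` to the trash-and-replace channel of `R[ρ^{⊗N}]`, and all three
fidelities agree there because the fidelity ignores a common tensor factor
(`fidelity_kronecker_left`).

The optimum for states is attained since channels form a compact set, parametrised by their Choi
matrices (`isCompact_channels`), and the worst-case fidelity is an infimum of continuous functions,
hence upper semicontinuous. The two constructions above transport the optimum to processes.
-/

namespace QCloning
open Matrix

/-! ### The trace norm and the fidelity -/

section TraceNorm

variable {n : Type} [Fintype n] [DecidableEq n]

/-- A polar decomposition `A = W |A|` with a contraction `W = A |A|⁺`, where `|A|⁺` is the
Moore–Penrose inverse. -/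
theorem exists_polar (A : Op n) :
    ∃ W : Op n, W * Wᴴ ≤ 1 ∧ W * CFC.abs A = A ∧ Wᴴ * A = CFC.abs A := by
  set H := CFC.abs A with hH
  have hHsa : IsSelfAdjoint H := (CFC.abs_nonneg A).isSelfAdjoint
  have hHH : H * H = Aᴴ * A := CFC.abs_mul_abs A
  have hc : ∀ f : ℝ → ℝ, ContinuousOn f (spectrum ℝ H) := fun f =>
    (Matrix.finite_real_spectrum (A := H)).continuousOn f
  -- since `0⁻¹ = 0`, this is the Moore–Penrose inverse of `|A|`
  set T : Op n := cfc (fun x : ℝ => x⁻¹) H with hT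
  have hTsa : Tᴴ = T := (cfc_predicate (fun x : ℝ => x⁻¹) H : IsSelfAdjoint T).star_eq
  have hid : cfc (fun x : ℝ => x) H = H := cfc_id' ℝ H
  have hTH : T * H = cfc (fun x : ℝ => x⁻¹ * x) H := by
    conv_lhs => rw [hT, ← hid, hid]
    rw [cfc_mul _ _ H (hc _) (hc _), hid]
  have hHT : H * T = T * H := by
    rw [hTH]
    have : cfc (fun x : ℝ => x * x⁻¹) H = H * T := by
      rw [cfc_mul _ _ H (hc _) (hc _), hid]
    rw [← this]
    congr 1; ext x; ring
  have hTHH : T * H * H = H := by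
    have : cfc (fun x : ℝ => x⁻¹ * x * x) H = T * H * H := by
      rw [cfc_mul _ _ H (hc _) (hc _), hid, hTH]
    rw [← this]
    conv_rhs => rw [← hid]
    congr 1; ext x
    by_cases hx : x = 0 <;> simp [hx]
  have hTHT : T * H * T = T := by
    have : cfc (fun x : ℝ => x⁻¹ * x * x⁻¹) H = T * H * T := by
      rw [cfc_mul _ _ H (hc _) (hc _), hTH]
    rw [← this, hT]
    congr 1; ext x
    by_cases hx : x = 0 <;> simp [hx]
  have hHsa' : Hᴴ = H := hHsa.star_eq
  refine ⟨A * T, ?_, ?_, ?_⟩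
  · -- `W W*` is an orthogonal projection
    set Q := A * T * (A * T)ᴴ with hQ
    have hQQ : Q * Q = Q := by
      have : Q * Q = A * (T * (T * (Aᴴ * A) * T) * T) * Aᴴ := by
        simp only [hQ, conjTranspose_mul, hTsa, Matrix.mul_assoc]
      rw [this, ← hHH, ← Matrix.mul_assoc T H H, hTHH, hHT, Matrix.mul_assoc T (T * H) T, hTHT]
      simp only [hQ, conjTranspose_mul, hTsa, Matrix.mul_assoc]
    have hQs : Qᴴ = Q := by simp [hQ]
    rw [Matrix.le_iff]
    have : (1 : Op n) - Q = (1 - Q)ᴴ * (1 - Q) := by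
      rw [conjTranspose_sub, conjTranspose_one, hQs]
      simp [Matrix.mul_sub, Matrix.sub_mul, hQQ]
    rw [this]
    exact posSemidef_conjTranspose_mul_self _
  · -- `(A T |A| - A)* (A T |A| - A) = 0`
    rw [← sub_eq_zero, ← Matrix.conjTranspose_mul_self_eq_zero]
    have : (A * T * H - A)ᴴ * (A * T * H - A)
        = (H * T - 1) * (Aᴴ * A) * (T * H - 1) := by
      simp only [conjTranspose_sub, conjTranspose_mul, hTsa, hHsa']
      noncomm_ring
    rw [this, ← hHH]
    have : (H * T - 1) * (H * H) = 0 := by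
      rw [hHT, Matrix.sub_mul, ← Matrix.mul_assoc, hTHH, Matrix.one_mul, sub_self]
    rw [this, Matrix.zero_mul]
  · rw [conjTranspose_mul, hTsa, Matrix.mul_assoc, ← hHH, ← Matrix.mul_assoc, hTHH]

omit [DecidableEq n] in
theorem trace_re_nonneg {A : Op n} (hA : A.PosSemidef) : 0 ≤ A.trace.re :=
  (Complex.le_def.1 hA.trace_nonneg).1

omit [DecidableEq n] in
theorem trace_re_mono {A B : Op n} (h : A ≤ B) : A.trace.re ≤ B.trace.re := by
  have := trace_re_nonneg (Matrix.le_iff.1 h)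
  simpa [trace_sub] using this

/-- With `A = W H` the polar decomposition, `0 ≤ tr (1 - W) H (1 - W)*`, and the right-hand side
equals `2 (tr H - Re tr A)`. -/
theorem trace_re_le_trace_abs (A : Op n) : A.trace.re ≤ (CFC.abs A).trace.re := by
  obtain ⟨W, -, hWA, hWH⟩ := exists_polar A
  have hH : (CFC.abs A).PosSemidef := (CFC.abs_nonneg A).posSemidef
  set H := CFC.abs A
  have hs : Hᴴ = H := hH.1
  have h := trace_re_nonneg (hH.mul_mul_conjTranspose_same (1 - W))
  have e : (1 - W) * H * (1 - W)ᴴ = H - A - Aᴴ + A * Wᴴ := by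
    have : Aᴴ = H * Wᴴ := by rw [← hWA, conjTranspose_mul, hs]
    rw [this, conjTranspose_sub, conjTranspose_one, Matrix.sub_mul, hWA]
    noncomm_ring
  rw [e, trace_add, trace_sub, trace_sub, trace_mul_comm A, hWH, trace_conjTranspose] at h
  simp at h
  linarith

/-- Operator monotonicity of the square root, applied to
`|C B|² = B* C* C B ≤ B* T B = |√T B|²`. -/
theorem trace_abs_mul_mono {C T B : Op n} (hT : T.PosSemidef) (h : Cᴴ * C ≤ T) :
    (CFC.abs (C * B)).trace.re ≤ (CFC.abs (CFC.sqrt T * B)).trace.re := by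
  -- the C⋆-norm, which induces the entrywise topology
  open scoped Matrix.Norms.L2Operator in
  refine trace_re_mono (CFC.sqrt_le_sqrt _ _ ?_)
  have hs : (CFC.sqrt T)ᴴ = CFC.sqrt T := (CFC.sqrt_nonneg T).posSemidef.1
  have e : star (CFC.sqrt T * B) * (CFC.sqrt T * B) = Bᴴ * T * B := by
    rw [star_eq_conjTranspose, conjTranspose_mul, hs, Matrix.mul_assoc,
      ← Matrix.mul_assoc (CFC.sqrt T), CFC.sqrt_mul_sqrt_self T hT.nonneg, Matrix.mul_assoc]
  have e' : star (C * B) * (C * B) = Bᴴ * (Cᴴ * C) * B := by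
    simp only [star_eq_conjTranspose, conjTranspose_mul, Matrix.mul_assoc]
  rw [e, e', Matrix.le_iff, ← Matrix.sub_mul, ← Matrix.mul_sub]
  exact (Matrix.le_iff.1 h).conjTranspose_mul_mul_same B

theorem fidelity_nonneg (ρ σ : Op n) : 0 ≤ fidelity ρ σ :=
  trace_re_nonneg (CFC.abs_nonneg _).posSemidef

theorem continuousOn_fidelity (σ : Op n) :
    ContinuousOn (fun ρ : Op n => fidelity ρ σ) {ρ | 0 ≤ ρ} := by
  -- the C⋆-norm, which induces the entrywise topology
  open scoped Matrix.Norms.L2Operator in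
  have h1 : ContinuousOn (fun ρ : Op n => CFC.sqrt ρ) {ρ | 0 ≤ ρ} := CFC.continuousOn_sqrt
  have h2 : Continuous (fun A : Op n => CFC.abs A) := CFC.continuous_abs
  have h3 : Continuous (fun A : Op n => A.trace.re) :=
    Complex.continuous_re.comp (continuous_id.matrix_trace)
  exact (h3.comp h2).comp_continuousOn (h1.mul continuousOn_const)

end TraceNorm

/-! ### Multiplicativity of the fidelity -/

section Kronecker

variable {m n : Type} [Fintype m] [DecidableEq m] [Fintype n] [DecidableEq n]

theorem sqrt_kronecker {A : Op m} {B : Op n} (hA : A.PosSemidef) (hB : B.PosSemidef) :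
    CFC.sqrt (A ⊗ₖ B) = CFC.sqrt A ⊗ₖ CFC.sqrt B := by
  refine CFC.sqrt_unique ?_ ?_
  · rw [← mul_kronecker_mul, CFC.sqrt_mul_sqrt_self A hA.nonneg,
      CFC.sqrt_mul_sqrt_self B hB.nonneg]
  · exact ((CFC.sqrt_nonneg A).posSemidef.kronecker (CFC.sqrt_nonneg B).posSemidef).nonneg

theorem abs_kronecker (A : Op m) (B : Op n) :
    CFC.abs (A ⊗ₖ B) = CFC.abs A ⊗ₖ CFC.abs B := by
  rw [CFC.abs, star_eq_conjTranspose, conjTranspose_kronecker, ← mul_kronecker_mul,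
    sqrt_kronecker (posSemidef_conjTranspose_mul_self A) (posSemidef_conjTranspose_mul_self B)]
  rfl

/-- The fidelity does not change when the same state is appended to both arguments. -/
theorem fidelity_kronecker_left {γ : Op m} {α β : Op n} (hγ : IsState γ) (hα : α.PosSemidef)
    (hβ : β.PosSemidef) : fidelity (γ ⊗ₖ α) (γ ⊗ₖ β) = fidelity α β := by
  have hγ' := hγ.posSemidef
  rw [fidelity, sqrt_kronecker hγ' hα, sqrt_kronecker hγ' hβ, ← mul_kronecker_mul, abs_kronecker,
    CFC.sqrt_mul_sqrt_self γ hγ'.nonneg, CFC.abs_of_nonneg γ hγ'.nonneg, trace_kronecker,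
    hγ.trace_eq_one, one_mul, fidelity]

end Kronecker

/-! ### Partial trace and monotonicity of the fidelity -/

section PartialTrace

variable {a b : Type} [Fintype a]

/-- The partial trace over the first tensor factor. -/
def traceFst (a b : Type) [Fintype a] : SuperOp (a × b) b where
  toFun X := Matrix.of fun i j => ∑ x, X (x, i) (x, j)
  map_add' X Y := by ext; simp [Finset.sum_add_distrib]
  map_smul' z X := by ext; simp [Finset.mul_sum]

theorem traceFst_apply (X : Op (a × b)) (i j : b) :
    traceFst a b X i j = ∑ x, X (x, i) (x, j) := rfl

theorem traceFst_eq_sum (X : Op (a × b)) :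
    traceFst a b X = ∑ x, X.submatrix (Prod.mk x) (Prod.mk x) := by
  ext i j
  simp [traceFst_apply, Matrix.sum_apply]

theorem traceFst_posSemidef {X : Op (a × b)} (hX : X.PosSemidef) :
    (traceFst a b X).PosSemidef := by
  rw [traceFst_eq_sum]
  exact Matrix.posSemidef_sum _ fun x _ => hX.submatrix _

theorem trace_traceFst [Fintype b] (X : Op (a × b)) : (traceFst a b X).trace = X.trace := by
  simp only [Matrix.trace, Matrix.diag, traceFst_apply]
  rw [Finset.sum_comm, Fintype.sum_prod_type]

theorem traceFst_kronecker (A : Op a) (B : Op b) : traceFst a b (A ⊗ₖ B) = A.trace • B := by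
  ext i j
  simp [traceFst_apply, Matrix.trace, Finset.sum_mul]

theorem traceFst_mul_one_kronecker [Fintype b] [DecidableEq a] (X : Op (a × b)) (B : Op b) :
    traceFst a b (X * ((1 : Op a) ⊗ₖ B)) = traceFst a b X * B := by
  ext i j
  simp only [traceFst_apply, Matrix.mul_apply, kroneckerMap_apply, Fintype.sum_prod_type,
    Matrix.one_apply, Finset.sum_mul]
  refine Eq.trans ?_ Finset.sum_comm
  simp

theorem traceFst_conjTranspose (X : Op (a × b)) : traceFst a b Xᴴ = (traceFst a b X)ᴴ := by
  ext i j
  simp [traceFst_apply, conjTranspose_apply]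

/-- Operator Cauchy–Schwarz inequality for the partial trace: the difference of the two sides is the
partial trace of `D* D`, where `D` is `K` minus `𝟙` tensored with the mean of its diagonal
blocks. -/
theorem traceFst_conjTranspose_mul_le [Fintype b] [DecidableEq a] (hd : Fintype.card a ≠ 0)
    (K : Op (a × b)) :
    (Fintype.card a : ℂ)⁻¹ • ((traceFst a b K)ᴴ * traceFst a b K) ≤ traceFst a b (Kᴴ * K) := by
  classical
  set c : ℂ := (Fintype.card a : ℂ)⁻¹ with hc
  have hc0 : (Fintype.card a : ℂ) * c = 1 := mul_inv_cancel₀ (by exact_mod_cast hd)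
  have hcs : star c = c := by simp [hc]
  set S := traceFst a b K with hS
  set D := K - (1 : Op a) ⊗ₖ (c • S) with hD
  have h : (traceFst a b (Dᴴ * D)).PosSemidef :=
    traceFst_posSemidef (posSemidef_conjTranspose_mul_self D)
  have e1 : traceFst a b (Kᴴ * (1 : Op a) ⊗ₖ (c • S)) = c • (Sᴴ * S) := by
    rw [traceFst_mul_one_kronecker, traceFst_conjTranspose, Matrix.mul_smul]
  have e2 : traceFst a b (((1 : Op a) ⊗ₖ (c • S))ᴴ * K) = c • (Sᴴ * S) := by
    have := congrArg conjTranspose e1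
    rw [← traceFst_conjTranspose, conjTranspose_mul, conjTranspose_conjTranspose,
      conjTranspose_smul, conjTranspose_mul, conjTranspose_conjTranspose, hcs] at this
    exact this
  have e3 : traceFst a b (((1 : Op a) ⊗ₖ (c • S))ᴴ * (1 : Op a) ⊗ₖ (c • S)) = c • (Sᴴ * S) := by
    rw [traceFst_mul_one_kronecker, conjTranspose_kronecker, conjTranspose_one,
      traceFst_kronecker, trace_one, conjTranspose_smul, hcs, smul_smul, hc0, one_smul,
      Matrix.mul_smul]
  have e : traceFst a b (Dᴴ * D) = traceFst a b (Kᴴ * K) - c • (Sᴴ * S) := by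
    rw [hD, conjTranspose_sub, Matrix.sub_mul, Matrix.mul_sub, Matrix.mul_sub, map_sub, map_sub,
      map_sub, e1, e2, e3]
    abel
  rw [Matrix.le_iff, ← e]
  exact h

/-- Monotonicity of the fidelity under the partial trace over a system that is maximally mixed
and uncorrelated in the second argument. -/
theorem fidelity_maxMixed_kronecker_le [DecidableEq a] [Fintype b] [DecidableEq b]
    (hd : Fintype.card a ≠ 0) {ρ : Op (a × b)} {σ : Op b} (hρ : ρ.PosSemidef)
    (hσ : σ.PosSemidef) :
    fidelity ρ (maxMixed a ⊗ₖ σ) ≤ fidelity (traceFst a b ρ) σ := by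
  set s : ℂ := (((Real.sqrt (Fintype.card a))⁻¹ : ℝ) : ℂ) with hs
  have hss : s * s = (Fintype.card a : ℂ)⁻¹ := by
    rw [hs, ← Complex.ofReal_mul, ← mul_inv, Real.mul_self_sqrt (Nat.cast_nonneg _)]
    simp
  have hs0 : 0 ≤ s := by rw [hs]; exact_mod_cast by positivity
  have hsqrt : CFC.sqrt (maxMixed a ⊗ₖ σ) = s • ((1 : Op a) ⊗ₖ CFC.sqrt σ) := by
    refine CFC.sqrt_unique ?_ ?_
    · rw [Matrix.smul_mul, Matrix.mul_smul, smul_smul, hss, ← mul_kronecker_mul,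
        CFC.sqrt_mul_sqrt_self σ hσ.nonneg, Matrix.one_mul, maxMixed, smul_kronecker]
    · exact ((PosSemidef.one.kronecker (CFC.sqrt_nonneg σ).posSemidef).smul hs0).nonneg
  have hr : (CFC.sqrt ρ)ᴴ = CFC.sqrt ρ := (CFC.sqrt_nonneg ρ).posSemidef.1
  obtain ⟨W, hW, -, hWA⟩ := exists_polar (CFC.sqrt ρ * CFC.sqrt (maxMixed a ⊗ₖ σ))
  set K := Wᴴ * CFC.sqrt ρ with hK
  set C := s • traceFst a b K with hC
  have hKK : Kᴴ * K ≤ ρ := by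
    rw [Matrix.le_iff]
    have : ρ - Kᴴ * K = (CFC.sqrt ρ)ᴴ * (1 - W * Wᴴ) * CFC.sqrt ρ := by
      rw [Matrix.mul_sub, Matrix.sub_mul, Matrix.mul_one, hr, CFC.sqrt_mul_sqrt_self ρ hρ.nonneg,
        hK, conjTranspose_mul, conjTranspose_conjTranspose, hr]
      simp only [Matrix.mul_assoc]
    rw [this]
    exact (Matrix.le_iff.1 hW).conjTranspose_mul_mul_same _
  have hCC : Cᴴ * C ≤ traceFst a b ρ := by
    have h1 : Cᴴ * C = (Fintype.card a : ℂ)⁻¹ • ((traceFst a b K)ᴴ * traceFst a b K) := by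
      rw [hC, conjTranspose_smul, Matrix.smul_mul, Matrix.mul_smul, smul_smul, ← hss]
      simp [hs]
    rw [h1]
    refine (traceFst_conjTranspose_mul_le hd K).trans ?_
    rw [Matrix.le_iff, ← map_sub]
    exact traceFst_posSemidef (Matrix.le_iff.1 hKK)
  calc fidelity ρ (maxMixed a ⊗ₖ σ)
      = (C * CFC.sqrt σ).trace.re := by
        rw [fidelity, ← hWA, hsqrt, ← Matrix.mul_assoc, ← hK, Matrix.mul_smul, ← trace_traceFst,
          map_smul, traceFst_mul_one_kronecker, hC, Matrix.smul_mul]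
    _ ≤ (CFC.abs (C * CFC.sqrt σ)).trace.re := trace_re_le_trace_abs _
    _ ≤ fidelity (traceFst a b ρ) σ := trace_abs_mul_mono (traceFst_posSemidef hρ) hCC

end PartialTrace

/-! ### Elementary channels -/

section Channels

variable {a b c : Type}

theorem idTensor_kronecker (Φ : SuperOp a b) (A : Op c) (B : Op a) :
    idTensor c Φ (A ⊗ₖ B) = A ⊗ₖ Φ B := by
  ext r s
  exact congrFun (congrFun (map_smul Φ (A r.1 s.1) B) r.2) s.2

/-- Positivity of `id ⊗ Φ` for an ancilla with an arbitrary finite index type. -/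
theorem IsCP.posSemidef_idTensor [Fintype c] {Φ : SuperOp a b} (h : IsCP Φ) {X : Op (c × a)}
    (hX : X.PosSemidef) : (idTensor c Φ X).PosSemidef := by
  classical
  let e := Fintype.equivFin c
  have h1 := h _ _ (hX.submatrix (fun r : Fin (Fintype.card c) × a => (e.symm r.1, r.2)))
  have h2 := h1.submatrix (fun r : c × b => (e r.1, r.2))
  convert h2 using 1
  ext r s
  simp [idTensor]

theorem IsCP.posSemidef {Φ : SuperOp a b} (h : IsCP Φ) {X : Op a}
    (hX : X.PosSemidef) : (Φ X).PosSemidef := by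
  have h1 := h 1 _ (hX.submatrix (fun r : Fin 1 × a => r.2))
  exact h1.submatrix (fun r : b => ((0 : Fin 1), r))

theorem IsCP.comp {Ψ : SuperOp b c} {Φ : SuperOp a b} (hΨ : IsCP Ψ) (hΦ : IsCP Φ) :
    IsCP (Ψ ∘ₗ Φ) := fun k X hX => hΨ k _ (hΦ k X hX)

theorem IsCP.idTensor [Fintype c] {Φ : SuperOp a b} (h : IsCP Φ) :
    IsCP (idTensor c Φ) := fun k X hX => by
  have h1 := h.posSemidef_idTensor
    (hX.submatrix (fun r : (Fin k × c) × a => (r.1.1, (r.1.2, r.2))))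
  exact h1.submatrix (fun r : Fin k × (c × b) => ((r.1, r.2.1), r.2.2))

theorem IsTP.idTensor [Fintype a] [Fintype b] [Fintype c] {Φ : SuperOp a b} (h : IsTP Φ) :
    IsTP (idTensor c Φ) := fun X => by
  simp only [Matrix.trace, Fintype.sum_prod_type]
  exact Finset.sum_congr rfl fun x _ => h (Matrix.of fun i j => X (x, i) (x, j))

theorem IsChannel.idTensor [Fintype a] [Fintype b] [Fintype c] {Φ : SuperOp a b}
    (h : IsChannel Φ) : IsChannel (idTensor c Φ) := ⟨h.cp.idTensor, h.tp.idTensor⟩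

theorem IsChannel.comp [Fintype a] [Fintype b] [Fintype c] {Ψ : SuperOp b c} {Φ : SuperOp a b}
    (hΨ : IsChannel Ψ) (hΦ : IsChannel Φ) : IsChannel (Ψ ∘ₗ Φ) :=
  ⟨hΨ.cp.comp hΦ.cp, fun X => (hΨ.tp _).trans (hΦ.tp X)⟩

theorem IsChannel.isState [Fintype a] [Fintype b] {Φ : SuperOp a b} (h : IsChannel Φ) {ρ : Op a}
    (hρ : IsState ρ) : IsState (Φ ρ) :=
  ⟨h.cp.posSemidef hρ.posSemidef, (h.tp ρ).trans hρ.trace_eq_one⟩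

/-- The relabelling of a basis. -/
def reindexOp (e : a ≃ b) : SuperOp a b where
  toFun X := X.submatrix e.symm e.symm
  map_add' _ _ := rfl
  map_smul' _ _ := rfl

theorem reindexOp_apply (e : a ≃ b) (X : Op a) (i j : b) :
    reindexOp e X i j = X (e.symm i) (e.symm j) := rfl

theorem isCP_reindexOp (e : a ≃ b) : IsCP (reindexOp e) := fun k _ hX =>
  hX.submatrix (fun r : Fin k × b => (r.1, e.symm r.2))

theorem isChannel_reindexOp [Fintype a] [Fintype b] (e : a ≃ b) : IsChannel (reindexOp e) :=
  ⟨isCP_reindexOp e, fun X => Equiv.sum_comp e.symm fun i => X i i⟩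

/-- The map `X ↦ X ⊗ Y`. -/
def kronRight (a : Type) {b : Type} (Y : Op b) : SuperOp a (a × b) where
  toFun X := X ⊗ₖ Y
  map_add' _ _ := Matrix.add_kronecker _ _ _
  map_smul' _ _ := Matrix.smul_kronecker _ _ _

theorem kronRight_apply (Y : Op b) (X : Op a) : kronRight a Y X = X ⊗ₖ Y := rfl

theorem isCP_kronRight [Fintype a] [Fintype b] {τ : Op b} (hτ : τ.PosSemidef) :
    IsCP (kronRight a τ) := fun k X hX => by
  classical
  exact (hX.kronecker hτ).submatrix (fun r : Fin k × (a × b) => ((r.1, r.2.1), r.2.2))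

theorem isChannel_kronRight [Fintype a] [Fintype b] {τ : Op b} (hτ : IsState τ) :
    IsChannel (kronRight a τ) :=
  ⟨isCP_kronRight hτ.posSemidef, fun X => by
    rw [kronRight_apply, trace_kronecker, hτ.trace_eq_one, mul_one]⟩

theorem isCP_traceFst [Fintype a] : IsCP (traceFst a b) := fun k X hX => by
  have : idTensor (Fin k) (traceFst a b) X = ∑ x, X.submatrix
      (fun r : Fin k × b => (r.1, (x, r.2))) (fun r : Fin k × b => (r.1, (x, r.2))) := by
    ext r s
    simp [idTensor, traceFst_apply, Matrix.sum_apply]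
  rw [this]
  exact Matrix.posSemidef_sum _ fun x _ => hX.submatrix _

theorem isChannel_traceFst [Fintype a] [Fintype b] : IsChannel (traceFst a b) :=
  ⟨isCP_traceFst, trace_traceFst⟩

/-- The partial trace over the second tensor factor. -/
def traceSnd (a b : Type) [Fintype b] : SuperOp (a × b) a :=
  traceFst b a ∘ₗ reindexOp (Equiv.prodComm a b)

theorem traceSnd_apply [Fintype b] (X : Op (a × b)) (i j : a) :
    traceSnd a b X i j = ∑ x, X (i, x) (j, x) := rfl

theorem traceSnd_kronecker [Fintype b] (A : Op a) (B : Op b) :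
    traceSnd a b (A ⊗ₖ B) = B.trace • A := by
  ext i j
  simp [traceSnd_apply, Matrix.trace, Finset.mul_sum, mul_comm]

theorem isChannel_traceSnd [Fintype a] [Fintype b] : IsChannel (traceSnd a b) :=
  isChannel_traceFst.comp (isChannel_reindexOp _)

/-- The map `Φ ⊗ id_c`. -/
def tensorId (c : Type) {a b : Type} (Φ : SuperOp a b) : SuperOp (a × c) (b × c) :=
  reindexOp (Equiv.prodComm c b) ∘ₗ idTensor c Φ ∘ₗ reindexOp (Equiv.prodComm a c)

theorem tensorId_kronecker (Φ : SuperOp a b) (A : Op a) (B : Op c) :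
    tensorId c Φ (A ⊗ₖ B) = Φ A ⊗ₖ B := by
  have h : reindexOp (Equiv.prodComm a c) (A ⊗ₖ B) = B ⊗ₖ A := by
    ext r s
    simp [reindexOp_apply, mul_comm]
  rw [tensorId, LinearMap.comp_apply, LinearMap.comp_apply, h, idTensor_kronecker]
  ext r s
  simp [reindexOp_apply, mul_comm]

theorem IsChannel.tensorId [Fintype a] [Fintype b] [Fintype c] {Φ : SuperOp a b}
    (h : IsChannel Φ) : IsChannel (tensorId c Φ) :=
  (isChannel_reindexOp _).comp (h.idTensor.comp (isChannel_reindexOp _))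

theorem trashReplace_apply [Fintype a] (σ : Op b) (X : Op a) :
    trashReplace a σ X = X.trace • σ := rfl

theorem isChannel_trashReplace [Fintype a] [Fintype b] {σ : Op b} (hσ : IsState σ) :
    IsChannel (trashReplace a σ) := by
  have : trashReplace a σ = traceFst a b ∘ₗ kronRight a σ := by
    refine LinearMap.ext fun X => ?_
    rw [LinearMap.comp_apply, kronRight_apply, traceFst_kronecker, trashReplace_apply]
  rw [this]
  exact isChannel_traceFst.comp (isChannel_kronRight hσ)

theorem isTP_trashReplace [Fintype a] [Fintype b] {σ : Op b} (hσ : σ.trace = 1) :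
    IsTP (trashReplace a σ) := fun X => by
  simp [trashReplace_apply, Matrix.trace_smul, hσ]

theorem idTensor_trashReplace [Fintype a] (σ : Op b) (X : Op (c × a)) :
    idTensor c (trashReplace a σ) X = traceSnd c a X ⊗ₖ σ := by
  ext r s
  rfl

end Channels

/-! ### Tensor products of operators -/

section TensorProd

variable {a b : Type} {N : ℕ}

/-- The tensor product `ρ₁ ⊗ ⋯ ⊗ ρ_N`. -/
def tensorProd (ρ : Fin N → Op a) : Op (Fin N → a) :=
  Matrix.of fun p q => ∏ i, ρ i (p i) (q i)

theorem tensorProd_apply (ρ : Fin N → Op a) (p q : Fin N → a) :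
    tensorProd ρ p q = ∏ i, ρ i (p i) (q i) := rfl

theorem tensorPow_eq (ρ : Op a) : tensorPow N ρ = tensorProd fun _ => ρ := rfl

theorem tensorProd_succ (ρ : Fin (N + 1) → Op a) :
    tensorProd ρ = (tensorProd (Fin.init ρ) ⊗ₖ ρ (Fin.last N)).submatrix
      (fun p => (Fin.init p, p (Fin.last N))) (fun p => (Fin.init p, p (Fin.last N))) := by
  ext p q
  simp [tensorProd_apply, Fin.prod_univ_castSucc, Fin.init]

theorem posSemidef_tensorProd [Fintype a] : ∀ {N : ℕ} {ρ : Fin N → Op a},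
    (∀ n, (ρ n).PosSemidef) → (tensorProd ρ).PosSemidef
  | 0, ρ, _ => by
    classical
    have : tensorProd ρ = 1 := by
      ext p q
      simp [tensorProd_apply, Matrix.one_apply, Subsingleton.elim p q]
    rw [this]
    exact PosSemidef.one
  | N + 1, ρ, h => by
    classical
    rw [tensorProd_succ]
    exact ((posSemidef_tensorProd fun n => h n.castSucc).kronecker (h _)).submatrix _

theorem trace_tensorProd [Fintype a] (ρ : Fin N → Op a) :
    (tensorProd ρ).trace = ∏ n, (ρ n).trace := by
  classical
  simp only [Matrix.trace, Matrix.diag, tensorProd_apply, Finset.prod_univ_sum,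
    Fintype.piFinset_univ]

theorem IsState.tensorPow [Fintype a] {ρ : Op a} (h : IsState ρ) (N : ℕ) :
    IsState (tensorPow N ρ) :=
  ⟨posSemidef_tensorProd fun _ => h.posSemidef, by
    rw [tensorPow_eq, trace_tensorProd]
    simp [h.trace_eq_one]⟩

theorem eq_sum_single [Fintype a] [DecidableEq a] (X : Op a) :
    X = ∑ p, ∑ q, X p q • Matrix.single p q (1 : ℂ) := by
  conv_lhs => rw [Matrix.matrix_eq_sum_single X]
  simp

theorem tensorMap_tensorProd [Fintype a] [DecidableEq a] (E : Fin N → SuperOp a b)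
    (ρ : Fin N → Op a) : tensorMap E (tensorProd ρ) = tensorProd fun n => E n (ρ n) := by
  ext r s
  have h : ∀ n, E n (ρ n) (r n) (s n)
      = ∑ p, ∑ q, ρ n p q * E n (Matrix.single p q 1) (r n) (s n) := fun n => by
    conv_lhs => rw [eq_sum_single (ρ n)]
    simp only [map_sum, map_smul, Matrix.sum_apply, Matrix.smul_apply, smul_eq_mul]
  rw [tensorProd_apply, Finset.prod_congr rfl fun n _ => h n, Finset.prod_univ_sum,
    Fintype.piFinset_univ]
  simp only [tensorMap, LinearMap.coe_mk, AddHom.coe_mk, Matrix.of_apply, tensorProd_apply,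
    ← Finset.prod_mul_distrib]
  refine Finset.sum_congr rfl fun p _ => ?_
  rw [Finset.prod_univ_sum, Fintype.piFinset_univ]

theorem tensorMap_trashReplace [Fintype a] [DecidableEq a] (ρ : Fin N → Op b) :
    tensorMap (fun n => trashReplace a (ρ n)) = trashReplace (Fin N → a) (tensorProd ρ) := by
  refine LinearMap.ext fun X => ?_
  ext r s
  have h : ∀ p q : Fin N → a, ∏ n, trashReplace a (ρ n) (Matrix.single (p n) (q n) 1) (r n) (s n)
      = if p = q then tensorProd ρ r s else 0 := fun p q => by
    split_ifs with hpq
    · subst hpq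
      exact Finset.prod_congr rfl fun n _ => by simp [trashReplace_apply]
    · obtain ⟨n, hn⟩ := Function.ne_iff.1 hpq
      exact Finset.prod_eq_zero (Finset.mem_univ n)
        (by simp [trashReplace_apply, Matrix.trace_single_eq_of_ne _ _ _ hn])
  simp only [tensorMap, LinearMap.coe_mk, AddHom.coe_mk, Matrix.of_apply, h]
  simp [trashReplace_apply, Matrix.trace, Finset.sum_mul]

/-- A linear functional of `ρ₁ ⊗ ⋯ ⊗ ρ_N` is multilinear in the factors. -/
theorem exists_multilinearMap [Fintype a] [DecidableEq a] (L : Op (Fin N → a) →ₗ[ℂ] ℂ) :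
    ∃ f : MultilinearMap ℂ (fun _ : Fin N => Op a) ℂ, ∀ ρ, f ρ = L (tensorProd ρ) := by
  refine ⟨∑ p, ∑ q, L (Matrix.single p q 1) •
    (MultilinearMap.mkPiAlgebra ℂ (Fin N) ℂ).compLinearMap
      (fun n => Matrix.entryLinearMap ℂ ℂ (p n) (q n)), fun ρ => ?_⟩
  conv_rhs => rw [eq_sum_single (tensorProd ρ)]
  simp only [map_sum, map_smul, smul_eq_mul]
  simp [tensorProd_apply, mul_comm]

/-- Every operator is a linear combination of two operators of trace one. -/
theorem exists_trace_one_combination [Fintype a] [Nonempty a] (X : Op a) :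
    ∃ (z w : ℂ) (A B : Op a), A.trace = 1 ∧ B.trace = 1 ∧ X = z • A + w • B := by
  classical
  obtain ⟨x⟩ := ‹Nonempty a›
  have h1 : (Matrix.single x x (1 : ℂ)).trace = 1 := by simp
  by_cases h : X.trace = 0
  · exact ⟨1, -1, X + Matrix.single x x 1, Matrix.single x x 1, by rw [trace_add, h, h1, zero_add],
      h1, by simp⟩
  · exact ⟨X.trace, 0, X.trace⁻¹ • X, Matrix.single x x 1, by simp [trace_smul, h], h1,
      by simp [smul_smul, h]⟩

/-- Products of operators of trace one span the operators on a tensor power. -/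
theorem linearMap_eq_zero_of_trace_one [Fintype a] [Nonempty a] (L : Op (Fin N → a) →ₗ[ℂ] ℂ)
    (h : ∀ ρ : Fin N → Op a, (∀ n, (ρ n).trace = 1) → L (tensorProd ρ) = 0) : L = 0 := by
  classical
  obtain ⟨f, hf⟩ := exists_multilinearMap L
  have key : ∀ (s : Finset (Fin N)) (ρ : Fin N → Op a), (∀ n ∉ s, (ρ n).trace = 1) → f ρ = 0 := by
    intro s
    induction s using Finset.induction_on with
    | empty => exact fun ρ hρ => (hf ρ).trans (h ρ fun n => hρ n (Finset.notMem_empty n))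
    | insert k s hk ih =>
      intro ρ hρ
      obtain ⟨z, w, A, B, hA, hB, hX⟩ := exists_trace_one_combination (ρ k)
      have hup : ∀ Y : Op a, Y.trace = 1 → f (Function.update ρ k Y) = 0 := fun Y hY =>
        ih _ fun n hn => by
          by_cases hnk : n = k
          · subst hnk; simpa using hY
          · simpa [hnk] using hρ n (by simp [hnk, hn])
      rw [← Function.update_eq_self k ρ, hX, f.map_update_add, f.map_update_smul,
        f.map_update_smul, hup A hA, hup B hB]
      simp
  refine LinearMap.ext fun X => ?_
  rw [eq_sum_single X, LinearMap.zero_apply]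
  simp only [map_sum, map_smul]
  refine Finset.sum_eq_zero fun p _ => Finset.sum_eq_zero fun q _ => ?_
  have : Matrix.single p q (1 : ℂ) = tensorProd fun n => Matrix.single (p n) (q n) (1 : ℂ) := by
    ext r s
    simp only [tensorProd_apply, Matrix.single_apply, Finset.prod_ite_zero, Finset.prod_const_one]
    simp [funext_iff, forall_and]
  rw [this, ← hf, key Finset.univ _ (by simp), smul_zero]

end TensorProd

/-! ### Contracting a process with trash-and-replace channels -/

section Contraction

variable {a b i o : Type} {N : ℕ}

theorem IsParallel.exists_contraction [Fintype a] [Fintype b] [Fintype i] [Fintype o]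
    {P : HigherMap N a b i o} (hP : IsParallel P) :
    ∃ G : SuperOp (i × (Fin N → b)) o, IsChannel G ∧
      ∀ (σ : Op (Fin N → b)) (X : Op i), P (trashReplace (Fin N → a) σ) X = G (X ⊗ₖ σ) := by
  obtain ⟨k, V, D, hV, hD, h⟩ := hP
  refine ⟨D ∘ₗ tensorId (Fin N → b) (traceSnd (Fin k) (Fin N → a) ∘ₗ V),
    hD.comp (isChannel_traceSnd.comp hV).tensorId, fun σ X => ?_⟩
  rw [h, LinearMap.comp_apply, LinearMap.comp_apply, idTensor_trashReplace, LinearMap.comp_apply,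
    tensorId_kronecker, LinearMap.comp_apply]

/-- Splitting off the last tensor factor. -/
def splitLast (i b : Type) (N : ℕ) : i × (Fin (N + 1) → b) ≃ (i × (Fin N → b)) × b where
  toFun x := ((x.1, Fin.init x.2), x.2 (Fin.last N))
  invFun y := (y.1.1, Fin.snoc (α := fun _ => b) y.1.2 y.2)
  left_inv x := by simp
  right_inv y := by simp

theorem reindexOp_splitLast (X : Op i) (ρ : Fin (N + 1) → Op b) :
    reindexOp (splitLast i b N) (X ⊗ₖ tensorProd ρ)
      = (X ⊗ₖ tensorProd (Fin.init ρ)) ⊗ₖ ρ (Fin.last N) := by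
  ext r s
  simp [reindexOp_apply, splitLast, tensorProd_apply, Fin.prod_univ_castSucc, Fin.init, mul_assoc]

theorem reindexOp_splitLast_symm (X : Op i) (ρ : Fin (N + 1) → Op b) :
    reindexOp (splitLast i b N).symm ((X ⊗ₖ tensorProd (Fin.init ρ)) ⊗ₖ ρ (Fin.last N))
      = X ⊗ₖ tensorProd ρ := by
  rw [← reindexOp_splitLast]
  ext r s
  simp [reindexOp_apply]

/-- Removing the one-dimensional tensor factor `H^{⊗0}`. -/
def prodPowZero (i b : Type) : i × (Fin 0 → b) ≃ i := Equiv.prodUnique i (Fin 0 → b)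

theorem reindexOp_prodPowZero (X : Op i) (ρ : Fin 0 → Op b) :
    reindexOp (prodPowZero i b) (X ⊗ₖ tensorProd ρ) = X := by
  ext r s
  simp [reindexOp_apply, prodPowZero, tensorProd_apply]

/-- The slots of the circuit are contracted one at a time: a trash-and-replace channel inserted
into the last slot discards the system sent to it and feeds the new state to the last channel. -/
theorem IsSeqCircuit.exists_contraction [Fintype a] [Fintype b] [Fintype i] :
    ∀ {N : ℕ} {o : Type} [Fintype o] {F : (Fin N → SuperOp a b) → SuperOp i o},
      IsSeqCircuit N o F →
      ∃ G : SuperOp (i × (Fin N → b)) o, IsChannel G ∧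
        ∀ (ρ : Fin N → Op b) (X : Op i),
          F (fun n => trashReplace a (ρ n)) X = G (X ⊗ₖ tensorProd ρ)
  | 0, o, _, F, h => by
    obtain ⟨V, hV, h⟩ := h
    refine ⟨V ∘ₗ reindexOp (prodPowZero i b), hV.comp (isChannel_reindexOp _), fun ρ X => ?_⟩
    rw [h, LinearMap.comp_apply, reindexOp_prodPowZero]
  | N + 1, o, _, F, h => by
    obtain ⟨k, F', V, hF', hV, h⟩ := h
    obtain ⟨G, hG, hGF⟩ := IsSeqCircuit.exists_contraction hF'
    refine ⟨V ∘ₗ tensorId b (traceSnd (Fin k) a ∘ₗ G) ∘ₗ reindexOp (splitLast i b N),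
      hV.comp ((isChannel_traceSnd.comp hG).tensorId.comp (isChannel_reindexOp _)),
      fun ρ X => ?_⟩
    rw [h, LinearMap.comp_apply, LinearMap.comp_apply, idTensor_trashReplace, LinearMap.comp_apply,
      LinearMap.comp_apply, reindexOp_splitLast, tensorId_kronecker, LinearMap.comp_apply,
      ← hGF (Fin.init ρ) X]
    rfl

/-- It suffices to check trace preservation on products `X ⊗ ρ₁ ⊗ ⋯ ⊗ ρ_N` with every `ρₙ` of
trace one, since these span. -/
theorem isTP_of_kronecker_tensorProd [Fintype b] [Nonempty b] [Fintype i] [Fintype o]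
    (G : SuperOp (i × (Fin N → b)) o)
    (h : ∀ (ρ : Fin N → Op b) (X : Op i), (∀ n, (ρ n).trace = 1) →
      (G (X ⊗ₖ tensorProd ρ)).trace = X.trace) : IsTP G := by
  classical
  have key : ∀ (X : Op i) (Y : Op (Fin N → b)), (G (X ⊗ₖ Y)).trace = (X ⊗ₖ Y).trace := by
    intro X Y
    let L : Op (Fin N → b) →ₗ[ℂ] ℂ :=
      (Matrix.traceLinearMap o ℂ ℂ ∘ₗ G - Matrix.traceLinearMap _ ℂ ℂ) ∘ₗ
        { toFun := fun Y => X ⊗ₖ Y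
          map_add' := fun _ _ => Matrix.kronecker_add _ _ _
          map_smul' := fun _ _ => Matrix.kronecker_smul _ _ _ }
    have hL : L = 0 := linearMap_eq_zero_of_trace_one L fun ρ hρ => by
      have := h ρ X hρ
      simp [L, this, trace_kronecker, trace_tensorProd, hρ]
    have := LinearMap.congr_fun hL Y
    simpa [L, sub_eq_zero] using this
  intro Z
  rw [eq_sum_single Z]
  simp only [map_sum, map_smul, Matrix.trace_sum, Matrix.trace_smul]
  refine Finset.sum_congr rfl fun p _ => Finset.sum_congr rfl fun q _ => ?_
  have : Matrix.single p q (1 : ℂ) = Matrix.single p.1 q.1 (1 : ℂ) ⊗ₖ Matrix.single p.2 q.2 1 := by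
    rw [Matrix.single_kronecker_single, mul_one]
  rw [this, key]

/-- A general process acts on the completely positive map `id_B ⊗ tr_A`, whose spectator input `B`
carries the operators to be prepared. Complete positivity of the contraction is that of the
resulting map; trace preservation follows from trace preservation on products of trace-one
operators. -/
theorem IsProcess.exists_contraction [Fintype a] [DecidableEq a] [Fintype b] [Nonempty b]
    [Fintype i] [Fintype o] {P : HigherMap N a b i o} (hP : IsProcess P) :
    ∃ G : SuperOp (i × (Fin N → b)) o, IsChannel G ∧
      ∀ (σ : Op (Fin N → b)) (X : Op i), P (trashReplace (Fin N → a) σ) X = G (X ⊗ₖ σ) := by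
  classical
  let e := Fintype.equivFin (Fin N → b)
  let A := Fin N → a
  let e₁ : Fin (Fintype.card (Fin N → b)) ≃ Fin 1 × (Fin N → b) :=
    e.symm.trans (Equiv.uniqueProd _ (Fin 1)).symm
  let Φ : SuperOp (Fin (Fintype.card (Fin N → b)) × A) (Fin 1 × (Fin N → b)) :=
    reindexOp e₁ ∘ₗ traceSnd _ A
  have hΦ : IsCP Φ := (isCP_reindexOp e₁).comp (isChannel_traceSnd).cp
  let f : i × (Fin N → b) ≃ Fin (Fintype.card (Fin N → b)) × i :=
    (Equiv.prodComm _ _).trans (Equiv.prodCongr e (Equiv.refl i))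
  let G : SuperOp (i × (Fin N → b)) o :=
    reindexOp (Equiv.uniqueProd o (Fin 1)) ∘ₗ extendHigher P Φ ∘ₗ reindexOp f
  have hblock : ∀ x x', block Φ x x' 0 0
      = trashReplace A (Matrix.single (e.symm x) (e.symm x') (1 : ℂ)) := by
    intro x x'
    refine LinearMap.ext fun X => ?_
    ext p q
    have : block Φ x x' 0 0 X p q = reindexOp e₁ (traceSnd _ A (Matrix.single x x' (1 : ℂ) ⊗ₖ X))
      (0, p) (0, q) := rfl
    rw [this, traceSnd_kronecker, map_smul, trashReplace_apply, Matrix.smul_apply,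
      Matrix.smul_apply, reindexOp_apply]
    simp [e₁, Matrix.single_apply, Equiv.symm_apply_eq]
  have hG : ∀ (σ : Op (Fin N → b)) (X : Op i), P (trashReplace A σ) X = G (X ⊗ₖ σ) := by
    intro σ X
    have hlin : trashReplace A σ
        = ∑ x, ∑ x', σ (e.symm x) (e.symm x') • block Φ x x' 0 0 := by
      refine LinearMap.ext fun Z => ?_
      have hσ : σ = ∑ x, ∑ x', σ (e.symm x) (e.symm x') •
          Matrix.single (e.symm x) (e.symm x') (1 : ℂ) := by
        conv_lhs => rw [eq_sum_single σ]
        rw [← Equiv.sum_comp e.symm]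
        exact Finset.sum_congr rfl fun x _ => (Equiv.sum_comp e.symm _).symm
      simp only [hblock, LinearMap.sum_apply, LinearMap.smul_apply, trashReplace_apply]
      conv_lhs => rw [hσ]
      simp only [Finset.smul_sum]
      exact Finset.sum_congr rfl fun x _ => Finset.sum_congr rfl fun x' _ => smul_comm _ _ _
    ext r s
    have hR : G (X ⊗ₖ σ) r s = ∑ x, ∑ x', P (block Φ x x' 0 0)
        (σ (e.symm x) (e.symm x') • X) r s := by
      have hX : ∀ x x', (Matrix.of fun p q => reindexOp f (X ⊗ₖ σ) (x, p) (x', q))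
          = σ (e.symm x) (e.symm x') • X := by
        intro x x'
        ext p q
        simp [reindexOp_apply, f, mul_comm]
      simp only [← hX]
      rfl
    rw [hR, hlin]
    simp only [map_sum, map_smul, LinearMap.sum_apply, LinearMap.smul_apply, Matrix.sum_apply]
  refine ⟨G, ⟨(isCP_reindexOp _).comp ((hP.ccpp _ _ Φ hΦ).comp (isCP_reindexOp f)), ?_⟩, hG⟩
  refine isTP_of_kronecker_tensorProd G fun ρ X hρ => ?_
  rw [← hG, ← tensorMap_trashReplace]
  exact hP.tpp _ (fun n => isTP_trashReplace (hρ n)) X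

/-- The three classes collapse once the slots are filled with trash-and-replace channels. -/
theorem ProcessClass.Mem.exists_contraction [Fintype a] [DecidableEq a] [Fintype b] [Nonempty b]
    [Fintype i] [Fintype o] {c : ProcessClass} {P : HigherMap N a b i o} (hP : c.Mem P) :
    ∃ G : SuperOp (i × (Fin N → b)) o, IsChannel G ∧ ∀ (ρ : Op b) (X : Op i),
      P (tensorMap fun _ => trashReplace a ρ) X = G (X ⊗ₖ tensorPow N ρ) := by
  cases c with
  | parallel =>
    obtain ⟨G, hG, h⟩ := IsParallel.exists_contraction hP
    exact ⟨G, hG, fun ρ X => by rw [tensorMap_trashReplace, h, tensorPow_eq]⟩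
  | sequential =>
    obtain ⟨G, hG, h⟩ := IsSeqCircuit.exists_contraction hP
    exact ⟨G, hG, fun ρ X => h (fun _ => ρ) X⟩
  | nonCausal =>
    obtain ⟨G, hG, h⟩ := IsProcess.exists_contraction hP
    exact ⟨G, hG, fun ρ X => by rw [tensorMap_trashReplace, h, tensorPow_eq]⟩

end Contraction

/-! ### Processes that probe their slots with a fixed state -/

section Probe

variable {a b i o : Type} {N : ℕ}

/-- The process that inserts the operator `τ` into its slots and applies `G` to its own input
together with the output of the slots. -/
def probe (N : ℕ) {a b i o : Type} (τ : Op (Fin N → a)) (G : SuperOp (i × (Fin N → b)) o) :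
    HigherMap N a b i o where
  toFun Φ := G ∘ₗ kronRight i (Φ τ)
  map_add' Φ Ψ := by
    refine LinearMap.ext fun X => ?_
    simp [kronRight_apply, Matrix.kronecker_add]
  map_smul' z Φ := by
    refine LinearMap.ext fun X => ?_
    simp [kronRight_apply, Matrix.kronecker_smul]

theorem probe_apply (τ : Op (Fin N → a)) (G : SuperOp (i × (Fin N → b)) o)
    (Φ : SuperOp (Fin N → a) (Fin N → b)) (X : Op i) : probe N τ G Φ X = G (X ⊗ₖ Φ τ) := rfl

variable [Fintype a] [Fintype b] [Fintype i] [Fintype o]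

theorem isParallel_probe {τ : Op (Fin N → a)} (hτ : IsState τ) {G : SuperOp (i × (Fin N → b)) o}
    (hG : IsChannel G) : IsParallel (probe N τ G) := by
  classical
  let e := Fintype.equivFin i
  refine ⟨Fintype.card i, kronRight _ τ ∘ₗ reindexOp e,
    G ∘ₗ reindexOp (Equiv.prodCongr e.symm (Equiv.refl _)),
    (isChannel_kronRight hτ).comp (isChannel_reindexOp _),
    hG.comp (isChannel_reindexOp _), fun Φ => LinearMap.ext fun X => ?_⟩
  rw [probe_apply]
  simp only [LinearMap.comp_apply, kronRight_apply, idTensor_kronecker]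
  congr 1
  ext r s
  simp [reindexOp_apply]

/-- A circuit that keeps all earlier outputs in memory and feeds a fresh copy of `τ` to each
slot. -/
theorem isSeqCircuit_probe {τ : Op a} (hτ : IsState τ) :
    ∀ {N : ℕ} {o : Type} [Fintype o] {G : SuperOp (i × (Fin N → b)) o}, IsChannel G →
      IsSeqCircuit N o fun E : Fin N → SuperOp a b =>
        G ∘ₗ kronRight i (tensorProd fun n => E n τ)
  | 0, o, _, G, hG => by
    refine ⟨G ∘ₗ reindexOp (prodPowZero i b).symm, hG.comp (isChannel_reindexOp _), fun E =>
      LinearMap.ext fun X => ?_⟩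
    simp only [LinearMap.comp_apply, kronRight_apply]
    congr 1
    ext r s
    simp [reindexOp_apply, prodPowZero, tensorProd_apply]
  | N + 1, o, _, G, hG => by
    classical
    let e := Fintype.equivFin (i × (Fin N → b))
    refine ⟨Fintype.card (i × (Fin N → b)),
      fun E => (kronRight _ τ ∘ₗ reindexOp e) ∘ₗ kronRight i (tensorProd fun n => E n τ),
      G ∘ₗ reindexOp (splitLast i b N).symm ∘ₗ reindexOp (Equiv.prodCongr e.symm (Equiv.refl _)),
      isSeqCircuit_probe hτ ((isChannel_kronRight hτ).comp (isChannel_reindexOp _)),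
      hG.comp ((isChannel_reindexOp _).comp (isChannel_reindexOp _)), fun E =>
      LinearMap.ext fun X => ?_⟩
    simp only [LinearMap.comp_apply, kronRight_apply, idTensor_kronecker]
    have h : reindexOp (Equiv.prodCongr e.symm (Equiv.refl b))
        (reindexOp e (X ⊗ₖ tensorProd fun n => Fin.init E n τ) ⊗ₖ E (Fin.last N) τ)
        = (X ⊗ₖ tensorProd (Fin.init fun n => E n τ)) ⊗ₖ E (Fin.last N) τ := by
      ext r s
      simp [reindexOp_apply, Fin.init, tensorProd_apply]
    rw [h, reindexOp_splitLast_symm X fun n => E n τ]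

variable [DecidableEq a]

theorem isSequential_probe {τ : Op a} (hτ : IsState τ) {G : SuperOp (i × (Fin N → b)) o}
    (hG : IsChannel G) : IsSequential (probe N (tensorPow N τ) G) := by
  have h := isSeqCircuit_probe (a := a) hτ hG
  have e : (fun E : Fin N → SuperOp a b => probe N (tensorPow N τ) G (tensorMap E))
      = fun E => G ∘ₗ kronRight i (tensorProd fun n => E n τ) := by
    funext E
    rw [← tensorMap_tensorProd E fun _ => τ]
    rfl
  rw [IsSequential, e]
  exact h

/-- Extending the probing process by spectators amounts to probing the extended map with `τ` on the
system it shares with the process. -/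
theorem isProcess_probe {τ : Op a} (hτ : IsState τ) {G : SuperOp (i × (Fin N → b)) o}
    (hG : IsChannel G) : IsProcess (probe N (tensorPow N τ) G) where
  tpp E hE X := by
    rw [probe_apply, hG.tp, trace_kronecker, tensorPow_eq, tensorMap_tensorProd, trace_tensorProd]
    simp [hE _ τ, hτ.trace_eq_one]
  ccpp k l Φ hΦ := by
    classical
    set τN := tensorPow N τ with hτN
    have hτN' : τN.PosSemidef := (hτ.tensorPow N).posSemidef
    -- `Fin k × i → i × (Fin k × H^{⊗N})`, then `id_i ⊗ Φ`, then the output of `Φ` is regrouped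
    let e₁ : (Fin k × i) × (Fin N → a) ≃ i × (Fin k × (Fin N → a)) :=
      (Equiv.prodCongr (Equiv.prodComm _ _) (Equiv.refl _)).trans (Equiv.prodAssoc _ _ _)
    let e₂ : i × (Fin l × (Fin N → b)) ≃ Fin l × (i × (Fin N → b)) :=
      ((Equiv.prodAssoc _ _ _).symm.trans
        (Equiv.prodCongr (Equiv.prodComm _ _) (Equiv.refl _))).trans (Equiv.prodAssoc _ _ _)
    have key : extendHigher (probe N τN G) Φ = idTensor (Fin l) G ∘ₗ reindexOp e₂ ∘ₗ
        idTensor i Φ ∘ₗ reindexOp e₁ ∘ₗ kronRight _ τN := by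
      refine LinearMap.ext fun Y => ?_
      ext r s
      have hsum : (Matrix.of fun p q => reindexOp e₂ (idTensor i Φ (reindexOp e₁ (Y ⊗ₖ τN)))
          (r.1, p) (s.1, q)) = ∑ x, ∑ x', (Matrix.of fun p q => Y (x, p) (x', q)) ⊗ₖ
            block Φ x x' r.1 s.1 τN := by
        ext p q
        have h1 : (Matrix.of fun u v => reindexOp e₁ (Y ⊗ₖ τN) (p.1, u) (q.1, v))
            = ∑ x, ∑ x', Y (x, p.1) (x', q.1) • (Matrix.single x x' (1 : ℂ) ⊗ₖ τN) := by
          ext u v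
          simp [Matrix.sum_apply, reindexOp_apply, e₁, Matrix.single_apply, ite_and]
        have h2 : reindexOp e₂ (idTensor i Φ (reindexOp e₁ (Y ⊗ₖ τN))) (r.1, p) (s.1, q)
            = Φ (Matrix.of fun u v => reindexOp e₁ (Y ⊗ₖ τN) (p.1, u) (q.1, v))
              (r.1, p.2) (s.1, q.2) := rfl
        rw [Matrix.of_apply, h2, h1]
        simp only [map_sum, map_smul, Matrix.sum_apply, Matrix.smul_apply, smul_eq_mul]
        rfl
      have hR : (idTensor (Fin l) G ∘ₗ reindexOp e₂ ∘ₗ idTensor i Φ ∘ₗ reindexOp e₁ ∘ₗ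
          kronRight _ τN) Y r s = G (Matrix.of fun p q => reindexOp e₂
            (idTensor i Φ (reindexOp e₁ (Y ⊗ₖ τN))) (r.1, p) (s.1, q)) r.2 s.2 := rfl
      rw [hR, hsum]
      simp only [map_sum, Matrix.sum_apply]
      rfl
    rw [key]
    exact hG.cp.idTensor.comp ((isCP_reindexOp _).comp (hΦ.idTensor.comp
      ((isCP_reindexOp _).comp (isCP_kronRight hτN'))))

theorem mem_probe {τ : Op a} (hτ : IsState τ) {G : SuperOp (i × (Fin N → b)) o}
    (hG : IsChannel G) (c : ProcessClass) : c.Mem (probe N (tensorPow N τ) G) := by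
  cases c with
  | parallel => exact isParallel_probe (hτ.tensorPow N) hG
  | sequential => exact isSequential_probe hτ hG
  | nonCausal => exact isProcess_probe hτ hG

omit [Fintype b] [Fintype i] [Fintype o] in
theorem query_probe_trashReplace {τ : Op a} (hτ : IsState τ) (G : SuperOp (i × (Fin N → b)) o)
    (ρ : Op b) (X : Op i) :
    (probe N (tensorPow N τ) G).query (trashReplace a ρ) X = G (X ⊗ₖ tensorPow N ρ) := by
  rw [HigherMap.query, probe_apply, tensorMap_trashReplace, trashReplace_apply,
    (hτ.tensorPow N).trace_eq_one, one_smul, tensorPow_eq]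

end Probe

/-! ### Compactness of the set of channels -/

section Compactness

variable {a b : Type} [Fintype a] [DecidableEq a]

/-- The linear map with unnormalised Choi matrix `J`. -/
def ofChoi (J : Op (a × b)) : SuperOp a b where
  toFun X := Matrix.of fun r s => ∑ p, ∑ q, X p q * J (p, r) (q, s)
  map_add' X Y := by
    ext r s
    simp [add_mul, Finset.sum_add_distrib]
  map_smul' z X := by
    ext r s
    simp [mul_assoc, Finset.mul_sum]

/-- The unnormalised Choi matrix `∑ |p⟩⟨q| ⊗ Φ(|p⟩⟨q|)`. -/
def choiMatrix (Φ : SuperOp a b) : Op (a × b) :=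
  Matrix.of fun r s => Φ (Matrix.single r.1 s.1 1) r.2 s.2

theorem ofChoi_choiMatrix (Φ : SuperOp a b) : ofChoi (choiMatrix Φ) = Φ := by
  refine LinearMap.ext fun X => ?_
  ext r s
  conv_rhs => rw [eq_sum_single X]
  simp only [map_sum, map_smul, Matrix.sum_apply, Matrix.smul_apply, smul_eq_mul]
  rfl

theorem choiMatrix_ofChoi (J : Op (a × b)) : choiMatrix (ofChoi J) = J := by
  ext r s
  simp [choiMatrix, ofChoi, Matrix.single_apply, ite_and]

theorem IsCP.posSemidef_choiMatrix {Φ : SuperOp a b} (h : IsCP Φ) :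
    (choiMatrix Φ).PosSemidef := by
  have : choiMatrix Φ = QCloning.idTensor a Φ (pureOp fun x => if x.1 = x.2 then 1 else 0) := by
    ext r s
    have : Matrix.single r.1 s.1 (1 : ℂ) = Matrix.of fun i j =>
        pureOp (fun x : a × a => if x.1 = x.2 then (1 : ℂ) else 0) (r.1, i) (s.1, j) := by
      ext i j
      by_cases h₁ : r.1 = i <;> by_cases h₂ : s.1 = j <;>
        simp [pureOp, Matrix.vecMulVec_apply, h₁, h₂]
    rw [choiMatrix, Matrix.of_apply, this]
    rfl
  rw [this]
  exact h.posSemidef_idTensor (Matrix.posSemidef_vecMulVec_self_star _)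

variable [Fintype b]

theorem IsTP.trace_choiMatrix {Φ : SuperOp a b} (h : IsTP Φ) :
    (choiMatrix Φ).trace = Fintype.card a := by
  have : ∀ x, ∑ y, Φ (Matrix.single x x 1) y y = 1 := fun x => by
    exact (h _).trans (Matrix.trace_single_eq_same x 1)
  simp [choiMatrix, Matrix.trace, Fintype.sum_prod_type, this]

/-- By positivity of the `2 × 2` principal minors. -/
theorem norm_apply_le_trace {n : Type} [Fintype n] {A : Op n} (hA : A.PosSemidef) (i j : n) :
    ‖A i j‖ ≤ A.trace.re := by
  have hd : ∀ k, 0 ≤ (A k k).re := fun k => (Complex.le_def.1 (hA.diag_nonneg (i := k))).1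
  have hle : ∀ k, (A k k).re ≤ A.trace.re := fun k => by
    rw [Matrix.trace, Complex.re_sum]
    exact Finset.single_le_sum (f := fun k => (A k k).re) (fun k _ => hd k) (Finset.mem_univ k)
  have him : ∀ k, (A k k).im = 0 := fun k =>
    (Complex.le_def.1 (hA.diag_nonneg (i := k))).2.symm
  have h := (Complex.le_def.1 (hA.submatrix ![i, j]).det_nonneg).1
  rw [Matrix.det_fin_two] at h
  have hji : A j i = star (A i j) := (hA.1.apply j i).symm
  simp [hji, him, Complex.mul_conj, Complex.normSq_eq_norm_sq] at h
  norm_cast at h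
  have h2 : ‖A i j‖ ^ 2 ≤ A.trace.re ^ 2 := by
    have := mul_le_mul (hle i) (hle j) (hd j) ((hd i).trans (hle i))
    nlinarith
  exact le_of_sq_le_sq h2 ((hd i).trans (hle i))

theorem isClosed_posSemidef (n : Type) [Fintype n] : IsClosed {A : Op n | A.PosSemidef} := by
  classical
  have h : {A : Op n | A.PosSemidef} = {A | 0 ≤ A} :=
    Set.ext fun A => Matrix.nonneg_iff_posSemidef.symm
  rw [h]
  -- the C⋆-norm, which induces the entrywise topology
  open scoped Matrix.Norms.L2Operator in
  exact CStarAlgebra.isClosed_nonneg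

omit [DecidableEq a] [Fintype b] in
theorem continuous_ofChoi_apply (X : Op a) :
    Continuous fun J : Op (a × b) => ofChoi J X := by
  refine continuous_matrix fun r s => ?_
  simp only [ofChoi, LinearMap.coe_mk, AddHom.coe_mk, Matrix.of_apply]
  fun_prop

theorem isCompact_channels : IsCompact {J : Op (a × b) | IsChannel (ofChoi J)} := by
  have hsub : {J : Op (a × b) | IsChannel (ofChoi J)} ⊆ Set.pi Set.univ fun _ =>
      Set.pi Set.univ fun _ => Metric.closedBall (0 : ℂ) (Fintype.card a) := by
    intro J hJ r _ s _
    have h1 := hJ.cp.posSemidef_choiMatrix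
    have h2 := hJ.tp.trace_choiMatrix
    rw [choiMatrix_ofChoi] at h1 h2
    have := norm_apply_le_trace h1 r s
    rw [h2] at this
    simpa using this
  refine (isCompact_univ_pi fun _ => isCompact_univ_pi fun _ =>
    isCompact_closedBall _ _).of_isClosed_subset ?_ hsub
  have hset : {J : Op (a × b) | IsChannel (ofChoi J)}
      = (⋂ (k : ℕ) (X : Op (Fin k × a)) (_ : X.PosSemidef),
          {J | (idTensor (Fin k) (ofChoi J) X).PosSemidef})
        ∩ ⋂ X : Op a, {J | (ofChoi J X).trace = X.trace} := by
    ext J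
    simp only [Set.mem_ofPred_eq, Set.mem_inter_iff, Set.mem_iInter]
    exact ⟨fun h => ⟨h.cp, h.tp⟩, fun h => ⟨h.1, h.2⟩⟩
  rw [hset]
  refine IsClosed.inter ?_ ?_
  · refine isClosed_iInter fun k => isClosed_iInter fun X => isClosed_iInter fun _ =>
      (isClosed_posSemidef _).preimage ?_
    exact continuous_matrix fun r s => (continuous_ofChoi_apply _).matrix_elem r.2 s.2
  · exact isClosed_iInter fun X =>
      isClosed_eq (continuous_ofChoi_apply X).matrix_trace continuous_const

end Compactness

theorem isState_maxMixed (a : Type) [Fintype a] [DecidableEq a] [Nonempty a] :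
    IsState (maxMixed a) where
  posSemidef := PosSemidef.one.smul (by positivity)
  trace_eq_one := by simp [maxMixed, Matrix.trace_smul]

/-- The infimum over `S` of the continuous functions `R ↦ F(R[ρ^{⊗N}], ρ^{⊗M})` is upper
semicontinuous, so that it attains its maximum on the compact set of channels. -/
theorem exists_isGreatest_stateCloningValues {a : Type} [Fintype a] [DecidableEq a] [Nonempty a]
    {S : Set (Op a)} (hS : ∀ ρ ∈ S, IsState ρ) (N M : ℕ) :
    ∃ v, IsGreatest (stateCloningValues S N M) v := by
  let K := {J : Op ((Fin N → a) × (Fin M → a)) | IsChannel (ofChoi J)}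
  have hK : IsCompact K := isCompact_channels
  have hne : K.Nonempty := ⟨choiMatrix (trashReplace _ (maxMixed _)), by
    simpa [K, ofChoi_choiMatrix] using isChannel_trashReplace (isState_maxMixed _)⟩
  let f : Op ((Fin N → a) × (Fin M → a)) → ℝ := fun J =>
    ⨅ ρ : S, fidelity (ofChoi J (tensorPow N ρ.1)) (tensorPow M ρ.1)
  have hf : UpperSemicontinuousOn f K := by
    refine upperSemicontinuousOn_ciInf (fun J _ => ⟨0, ?_⟩) fun ρ => ?_
    · rintro _ ⟨ρ, rfl⟩
      exact fidelity_nonneg _ _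
    · refine ContinuousOn.upperSemicontinuousOn ?_
      refine (continuousOn_fidelity _).comp (continuous_ofChoi_apply _).continuousOn fun J hJ => ?_
      exact (hJ.isState ((hS ρ.1 ρ.2).tensorPow N)).posSemidef.nonneg
  obtain ⟨J, hJ, hmax⟩ := hf.exists_isMaxOn hne hK
  refine ⟨f J, ⟨ofChoi J, hJ, rfl⟩, ?_⟩
  rintro _ ⟨R, hR, rfl⟩
  have hR' : choiMatrix R ∈ K := by simpa [K, ofChoi_choiMatrix] using hR
  have := hmax hR'
  simpa [f, ofChoi_choiMatrix] using this

/-! ### Fidelities of trash-and-replace channels -/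

section ChannelFidelities

variable {a b : Type} [Fintype a] [DecidableEq a] [Fintype b] [DecidableEq b]

omit [DecidableEq a] in
theorem isState_traceSnd_pureOp {ψ : a × a → ℂ} (hψ : star ψ ⬝ᵥ ψ = 1) :
    IsState (traceSnd a a (pureOp ψ)) :=
  isChannel_traceSnd.isState ⟨Matrix.posSemidef_vecMulVec_self_star _, by
    rw [pureOp, Matrix.trace_vecMulVec, dotProduct_comm, hψ]⟩

theorem pureOp_maxEntVec_apply (x y : a × a) :
    pureOp (maxEntVec a) x y
      = if x.1 = x.2 then if y.1 = y.2 then (Fintype.card a : ℂ)⁻¹ else 0 else 0 := by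
  have h : (((Real.sqrt (Fintype.card a))⁻¹ : ℝ) : ℂ) * (((Real.sqrt (Fintype.card a))⁻¹ : ℝ) : ℂ)
      = (Fintype.card a : ℂ)⁻¹ := by
    rw [← Complex.ofReal_mul, ← mul_inv, Real.mul_self_sqrt (Nat.cast_nonneg _)]
    simp
  rw [← h]
  by_cases h₁ : x.1 = x.2 <;> by_cases h₂ : y.1 = y.2 <;>
    simp [pureOp, Matrix.vecMulVec_apply, maxEntVec, h₁, h₂]

theorem traceSnd_pureOp_maxEntVec :
    traceSnd a a (pureOp (maxEntVec a)) = maxMixed a := by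
  ext i j
  simp [traceSnd_apply, pureOp_maxEntVec_apply, maxMixed, Matrix.one_apply, eq_comm]

theorem star_maxEntVec_dotProduct [Nonempty a] : star (maxEntVec a) ⬝ᵥ maxEntVec a = 1 := by
  rw [dotProduct_comm, ← Matrix.trace_vecMulVec]
  exact (isChannel_traceSnd.tp _).symm.trans
    (traceSnd_pureOp_maxEntVec (a := a) ▸ (isState_maxMixed a).trace_eq_one)

omit [Fintype b] [DecidableEq b] in
theorem choi_trashReplace (σ : Op b) :
    choi (trashReplace a σ) = maxMixed a ⊗ₖ σ := by
  rw [choi, idTensor_trashReplace, traceSnd_pureOp_maxEntVec]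

omit [Fintype b] [DecidableEq b] in
theorem traceFst_choi (A : SuperOp a b) :
    traceFst a b (choi A) = A (maxMixed a) := by
  have h : maxMixed a = ∑ x, Matrix.of fun i j => pureOp (maxEntVec a) (x, i) (x, j) := by
    ext i j
    simp [Matrix.sum_apply, pureOp_maxEntVec_apply, maxMixed, Matrix.one_apply]
  rw [h, map_sum]
  ext i j
  rw [Matrix.sum_apply]
  rfl

theorem fidCJ_trashReplace_le [Nonempty a] {A : SuperOp a b} (hA : IsCP A) {σ : Op b}
    (hσ : σ.PosSemidef) : fidCJ A (trashReplace a σ) ≤ fidelity (A (maxMixed a)) σ := by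
  rw [fidCJ, choi_trashReplace, ← traceFst_choi]
  exact fidelity_maxMixed_kronecker_le Fintype.card_ne_zero
    (hA.posSemidef_idTensor (Matrix.posSemidef_vecMulVec_self_star _)) hσ

theorem fidCJ_trashReplace [Nonempty a] {α β : Op b} (hα : α.PosSemidef) (hβ : β.PosSemidef) :
    fidCJ (trashReplace a α) (trashReplace a β) = fidelity α β := by
  rw [fidCJ, choi_trashReplace, choi_trashReplace,
    fidelity_kronecker_left (isState_maxMixed a) hα hβ]

theorem fidDiamond_trashReplace [Nonempty a] {α β : Op b} (hα : α.PosSemidef)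
    (hβ : β.PosSemidef) :
    fidDiamond (trashReplace a α) (trashReplace a β) = fidelity α β := by
  have : Nonempty {ψ : a × a → ℂ // star ψ ⬝ᵥ ψ = 1} := ⟨⟨_, star_maxEntVec_dotProduct⟩⟩
  have h : ∀ ψ : {ψ : a × a → ℂ // star ψ ⬝ᵥ ψ = 1},
      fidelity (idTensor a (trashReplace a α) (pureOp ψ.1))
        (idTensor a (trashReplace a β) (pureOp ψ.1)) = fidelity α β := fun ψ => by
    rw [idTensor_trashReplace, idTensor_trashReplace,
      fidelity_kronecker_left (isState_traceSnd_pureOp ψ.2) hα hβ]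
  rw [fidDiamond, iInf_congr h, ciInf_const]

theorem fidDiamond_nonneg (A B : SuperOp a b) : 0 ≤ fidDiamond A B :=
  Real.iInf_nonneg fun _ => fidelity_nonneg _ _

theorem fidDiamond_le_fidCJ [Nonempty a] (A B : SuperOp a b) : fidDiamond A B ≤ fidCJ A B :=
  ciInf_le (f := fun ψ : {ψ : a × a → ℂ // star ψ ⬝ᵥ ψ = 1} =>
      fidelity (idTensor a A (pureOp ψ.1)) (idTensor a B (pureOp ψ.1)))
    ⟨0, by rintro _ ⟨ψ, rfl⟩; exact fidelity_nonneg _ _⟩ ⟨_, star_maxEntVec_dotProduct⟩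

end ChannelFidelities

/-! ### Cloning states and cloning trash-and-replace channels -/

section Cloning

variable {a : Type} [Fintype a] [DecidableEq a] [Nonempty a] {N M : ℕ}

/-- A channel `G` on the input and the `N` prepared states is realised in all three classes by
probing the slots with the maximally mixed state. -/
theorem exists_process_of_channel {b i o : Type} [Fintype b] [Fintype i] [Fintype o]
    {G : SuperOp (i × (Fin N → b)) o} (hG : IsChannel G) :
    ∃ P : HigherMap N a b i o, (∀ c : ProcessClass, c.Mem P) ∧
      ∀ (ρ : Op b) (X : Op i), P.query (trashReplace a ρ) X = G (X ⊗ₖ tensorPow N ρ) :=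
  ⟨_, mem_probe (isState_maxMixed a) hG, query_probe_trashReplace (isState_maxMixed a) G⟩

/-- The process that discards its input and prepares the output of a cloning map `R`. -/
theorem exists_process_of_cloningMap {R : SuperOp (Fin N → a) (Fin M → a)} (hR : IsChannel R) :
    ∃ P : HigherMap N a a (Fin M → a) (Fin M → a), (∀ c : ProcessClass, c.Mem P) ∧
      ∀ ρ : Op a, IsState ρ →
        P.query (trashReplace a ρ) = trashReplace (Fin M → a) (R (tensorPow N ρ)) ∧
        fidCJ (P.query (trashReplace a ρ)) (tensorMap fun _ => trashReplace a ρ)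
          = fidelity (R (tensorPow N ρ)) (tensorPow M ρ) ∧
        fidDiamond (P.query (trashReplace a ρ)) (tensorMap fun _ => trashReplace a ρ)
          = fidelity (R (tensorPow N ρ)) (tensorPow M ρ) := by
  obtain ⟨P, hP, h⟩ := exists_process_of_channel (a := a)
    (hR.comp (isChannel_traceFst (a := Fin M → a) (b := Fin N → a)))
  refine ⟨P, hP, fun ρ hρ => ?_⟩
  have hq : P.query (trashReplace a ρ) = trashReplace (Fin M → a) (R (tensorPow N ρ)) := by
    refine LinearMap.ext fun X => ?_
    rw [h, LinearMap.comp_apply, traceFst_kronecker, map_smul, trashReplace_apply]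
  have h1 := (hR.isState (hρ.tensorPow N)).posSemidef
  have h2 := (hρ.tensorPow M).posSemidef
  rw [hq, tensorMap_trashReplace, ← tensorPow_eq]
  exact ⟨rfl, fidCJ_trashReplace h1 h2, fidDiamond_trashReplace h1 h2⟩

/-- Feeding the maximally mixed state into the contracted process yields a cloning map for states.
Its fidelity dominates the CJ fidelity because discarding the reference system of the
Choi–Jamiołkowski state leaves the output on the maximally mixed input. -/
theorem exists_cloningMap_of_process {c : ProcessClass}
    {P : HigherMap N a a (Fin M → a) (Fin M → a)} (hP : c.Mem P) :
    ∃ R : SuperOp (Fin N → a) (Fin M → a), IsChannel R ∧ ∀ ρ : Op a, IsState ρ →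
      R (tensorPow N ρ) = P.query (trashReplace a ρ) (maxMixed (Fin M → a)) ∧
      (∀ σ : Op (Fin M → a), P.query (trashReplace a ρ) = trashReplace (Fin M → a) σ →
        P.query (trashReplace a ρ) = trashReplace (Fin M → a) (R (tensorPow N ρ))) ∧
      fidDiamond (P.query (trashReplace a ρ)) (tensorMap fun _ => trashReplace a ρ)
        ≤ fidCJ (P.query (trashReplace a ρ)) (tensorMap fun _ => trashReplace a ρ) ∧
      fidCJ (P.query (trashReplace a ρ)) (tensorMap fun _ => trashReplace a ρ)
        ≤ fidelity (R (tensorPow N ρ)) (tensorPow M ρ) := by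
  obtain ⟨G, hG, h⟩ := hP.exists_contraction
  have hm := isState_maxMixed (Fin M → a)
  refine ⟨G ∘ₗ reindexOp (Equiv.prodComm _ _) ∘ₗ kronRight _ (maxMixed (Fin M → a)),
    hG.comp ((isChannel_reindexOp _).comp (isChannel_kronRight hm)), fun ρ hρ => ?_⟩
  have hR : (G ∘ₗ reindexOp (Equiv.prodComm _ _) ∘ₗ kronRight _ (maxMixed (Fin M → a)))
      (tensorPow N ρ) = P.query (trashReplace a ρ) (maxMixed (Fin M → a)) := by
    rw [HigherMap.query, h]
    simp only [LinearMap.comp_apply, kronRight_apply]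
    congr 1
    ext r s
    simp [reindexOp_apply, mul_comm]
  refine ⟨hR, fun σ hσ => ?_, fidDiamond_le_fidCJ _ _, ?_⟩
  · rw [hR, hσ, trashReplace_apply, hm.trace_eq_one, one_smul]
  · have hq : P.query (trashReplace a ρ) = G ∘ₗ kronRight _ (tensorPow N ρ) :=
      LinearMap.ext fun X => h ρ X
    rw [hR, tensorMap_trashReplace, ← tensorPow_eq]
    refine fidCJ_trashReplace_le ?_ (hρ.tensorPow M).posSemidef
    rw [hq]
    exact hG.cp.comp (isCP_kronRight (hρ.tensorPow N).posSemidef)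

omit [Nonempty a] in
/-- A channel figure of merit that is bounded by the fidelity of the associated cloning maps, with
equality for the processes built from cloning maps, has the optimal value of state cloning. -/
theorem isGreatest_channelCloningValues {S : Set (Op a)} (hS : ∀ ρ ∈ S, IsState ρ) {v : ℝ}
    (hv : IsGreatest (stateCloningValues S N M) v) (c : ProcessClass)
    (F : SuperOp (Fin M → a) (Fin M → a) → SuperOp (Fin M → a) (Fin M → a) → ℝ)
    (hF0 : ∀ A B, 0 ≤ F A B)
    (hF1 : ∀ R : SuperOp (Fin N → a) (Fin M → a), IsChannel R →
      ∃ P : HigherMap N a a (Fin M → a) (Fin M → a), c.Mem P ∧ ∀ ρ : Op a, IsState ρ →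
        F (P.query (trashReplace a ρ)) (tensorMap fun _ => trashReplace a ρ)
          = fidelity (R (tensorPow N ρ)) (tensorPow M ρ))
    (hF2 : ∀ P : HigherMap N a a (Fin M → a) (Fin M → a), c.Mem P →
      ∃ R : SuperOp (Fin N → a) (Fin M → a), IsChannel R ∧ ∀ ρ : Op a, IsState ρ →
        F (P.query (trashReplace a ρ)) (tensorMap fun _ => trashReplace a ρ)
          ≤ fidelity (R (tensorPow N ρ)) (tensorPow M ρ)) :
    IsGreatest (channelCloningValues c (trashReplace a '' S) N M F) v := by
  have hinf : ∀ P : HigherMap N a a (Fin M → a) (Fin M → a),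
      ⨅ E : trashReplace a '' S, F (P.query E.1) (tensorMap fun _ => E.1)
        = ⨅ ρ : S, F (P.query (trashReplace a ρ.1)) (tensorMap fun _ => trashReplace a ρ.1) :=
    fun P => ((Set.imageFactorization_surjective (f := trashReplace a) (s := S)).iInf_comp
      fun E : trashReplace a '' S => F (P.query E.1) (tensorMap fun _ => E.1)).symm
  constructor
  · obtain ⟨R, hR, hvR⟩ := hv.1
    obtain ⟨P, hP, h⟩ := hF1 R hR
    refine ⟨P, hP, ?_⟩
    rw [hinf, hvR]
    exact iInf_congr fun ρ => (h ρ.1 (hS ρ.1 ρ.2)).symm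
  · rintro _ ⟨P, hP, rfl⟩
    obtain ⟨R, hR, h⟩ := hF2 P hP
    rw [hinf]
    refine le_trans (ciInf_mono ⟨0, ?_⟩ fun ρ => h ρ.1 (hS ρ.1 ρ.2)) (hv.2 ⟨R, hR, rfl⟩)
    rintro _ ⟨ρ, rfl⟩
    exact hF0 _ _

end Cloning

theorem IsState.nonempty {a : Type} [Fintype a] {ρ : Op a} (h : IsState ρ) : Nonempty a := by
  by_contra hne
  rw [not_nonempty_iff] at hne
  simpa [Matrix.trace] using h.trace_eq_one

end QCloning

theorem proposition1 (d N M : ℕ) (S : Set (Op (Fin d))) (hne : S.Nonempty)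
    (hS : ∀ ρ ∈ S, IsState ρ) :
    -- optimal cloning of states and of trash-and-replace channels coincide, and optima are attained
    (IsGreatest (stateCloningValues S N M) (optStateFid S N M) ∧
      ∀ c : ProcessClass,
        optCJFid c (trashReplace (Fin d) '' S) N M
            = optDiamondFid c (trashReplace (Fin d) '' S) N M ∧
        optDiamondFid c (trashReplace (Fin d) '' S) N M = optStateFid S N M ∧
        IsGreatest (channelCloningValues c (trashReplace (Fin d) '' S) N M fidCJ)
          (optCJFid c (trashReplace (Fin d) '' S) N M) ∧
        IsGreatest (channelCloningValues c (trashReplace (Fin d) '' S) N M fidDiamond)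
          (optDiamondFid c (trashReplace (Fin d) '' S) N M)) ∧
    -- from cloning maps to cloning processes
    (∀ R : SuperOp (Fin N → Fin d) (Fin M → Fin d), IsChannel R →
      ∃ P : HigherMap N (Fin d) (Fin d) (Fin M → Fin d) (Fin M → Fin d),
        (∀ c : ProcessClass, c.Mem P) ∧
        ∀ ρ : Op (Fin d), IsState ρ →
          P.query (trashReplace (Fin d) ρ)
            = trashReplace (Fin M → Fin d) (R (tensorPow N ρ)) ∧
          fidCJ (P.query (trashReplace (Fin d) ρ)) (tensorMap fun _ => trashReplace (Fin d) ρ)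
            = fidelity (R (tensorPow N ρ)) (tensorPow M ρ) ∧
          fidDiamond (P.query (trashReplace (Fin d) ρ))
              (tensorMap fun _ => trashReplace (Fin d) ρ)
            = fidelity (R (tensorPow N ρ)) (tensorPow M ρ)) ∧
    -- from cloning processes to cloning maps
    (∀ (c : ProcessClass) (P : HigherMap N (Fin d) (Fin d) (Fin M → Fin d) (Fin M → Fin d)),
      c.Mem P →
      ∃ R : SuperOp (Fin N → Fin d) (Fin M → Fin d), IsChannel R ∧
        ∀ ρ : Op (Fin d), IsState ρ →
          R (tensorPow N ρ) = P.query (trashReplace (Fin d) ρ) (maxMixed (Fin M → Fin d)) ∧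
          (∀ σ : Op (Fin M → Fin d),
            P.query (trashReplace (Fin d) ρ) = trashReplace (Fin M → Fin d) σ →
            P.query (trashReplace (Fin d) ρ)
              = trashReplace (Fin M → Fin d) (R (tensorPow N ρ))) ∧
          fidDiamond (P.query (trashReplace (Fin d) ρ))
              (tensorMap fun _ => trashReplace (Fin d) ρ)
            ≤ fidCJ (P.query (trashReplace (Fin d) ρ))
              (tensorMap fun _ => trashReplace (Fin d) ρ) ∧
          fidCJ (P.query (trashReplace (Fin d) ρ)) (tensorMap fun _ => trashReplace (Fin d) ρ)
            ≤ fidelity (R (tensorPow N ρ)) (tensorPow M ρ)) ∧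
    -- contracting a process with trash-and-replace channels: the three classes collapse
    (∀ (c : ProcessClass) (P : HigherMap N (Fin d) (Fin d) (Fin M → Fin d) (Fin M → Fin d)),
      c.Mem P →
      ∃ G : SuperOp ((Fin M → Fin d) × (Fin N → Fin d)) (Fin M → Fin d), IsChannel G ∧
        ∀ ρ : Op (Fin d), IsState ρ → ∀ X : Op (Fin M → Fin d),
          P.query (trashReplace (Fin d) ρ) X = G (X ⊗ₖ tensorPow N ρ)) ∧
    (∀ G : SuperOp ((Fin M → Fin d) × (Fin N → Fin d)) (Fin M → Fin d), IsChannel G →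
      ∃ P : HigherMap N (Fin d) (Fin d) (Fin M → Fin d) (Fin M → Fin d),
        (∀ c : ProcessClass, c.Mem P) ∧
        ∀ ρ : Op (Fin d), IsState ρ → ∀ X : Op (Fin M → Fin d),
          P.query (trashReplace (Fin d) ρ) X = G (X ⊗ₖ tensorPow N ρ)) := by
  obtain ⟨ρ₀, hρ₀⟩ := hne
  have : Nonempty (Fin d) := (hS ρ₀ hρ₀).nonempty
  obtain ⟨v, hv⟩ := exists_isGreatest_stateCloningValues hS N M
  have hCJ : ∀ c, IsGreatest
      (channelCloningValues c (trashReplace (Fin d) '' S) N M fidCJ) v := fun c => by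
    refine isGreatest_channelCloningValues hS hv c fidCJ (fun _ _ => fidelity_nonneg _ _)
      (fun R hR => ?_) fun P hP => ?_
    · obtain ⟨P, hP, h⟩ := exists_process_of_cloningMap hR
      exact ⟨P, hP c, fun ρ hρ => (h ρ hρ).2.1⟩
    · obtain ⟨R, hR, h⟩ := exists_cloningMap_of_process hP
      exact ⟨R, hR, fun ρ hρ => (h ρ hρ).2.2.2⟩
  have hDi : ∀ c, IsGreatest
      (channelCloningValues c (trashReplace (Fin d) '' S) N M fidDiamond) v := fun c => by
    refine isGreatest_channelCloningValues hS hv c fidDiamond fidDiamond_nonneg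
      (fun R hR => ?_) fun P hP => ?_
    · obtain ⟨P, hP, h⟩ := exists_process_of_cloningMap hR
      exact ⟨P, hP c, fun ρ hρ => (h ρ hρ).2.2⟩
    · obtain ⟨R, hR, h⟩ := exists_cloningMap_of_process hP
      exact ⟨R, hR, fun ρ hρ => (h ρ hρ).2.2.1.trans (h ρ hρ).2.2.2⟩
  have hSv : optStateFid S N M = v := hv.csSup_eq
  have hCJv : ∀ c, optCJFid c (trashReplace (Fin d) '' S) N M = v := fun c => (hCJ c).csSup_eq
  have hDiv : ∀ c, optDiamondFid c (trashReplace (Fin d) '' S) N M = v := fun c =>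
    (hDi c).csSup_eq
  refine ⟨⟨hSv ▸ hv, fun c => ⟨(hCJv c).trans (hDiv c).symm, (hDiv c).trans hSv.symm,
    (hCJv c).symm ▸ hCJ c, (hDiv c).symm ▸ hDi c⟩⟩, fun R hR => exists_process_of_cloningMap hR,
    fun c P hP => exists_cloningMap_of_process hP, fun c P hP => ?_, fun G hG => ?_⟩
  · obtain ⟨G, hG, h⟩ := hP.exists_contraction
    exact ⟨G, hG, fun ρ _ => h ρ⟩
  · obtain ⟨P, hP, h⟩ := exists_process_of_channel (a := Fin d) hG
    exact ⟨P, hP, fun ρ _ => h ρ⟩
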